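/- Let $M$ be a connected Kähler manifold of indefinite metric: a connected smooth manifold with a smooth pseudo-Riemannian metric $g$ of signature $(2s,2(n-s))$ ($2s$ negative and $2(n-s)$ positive directions, so $\dim M=2n$) and a smooth almost complex structure $J$ such that $J^2=-\mathrm{id}$, $g(JX,JY)=g(X,Y)$ and $\nabla J=0$, where $\nabla$ is the Levi-Civita connection of $g$. Assume $s\ge 2$ and $n-s\ge 2$. A 2-dimensional subspace $\alpha\subset T_pM$ is called strongly isotropic if $g$ vanishes identically on $\alpha$, nondegenerate if $g|_\alpha$ has rank 2, holomorphic if $J\alpha=\alpha$, and antiholomorphic if $J\alpha\perp\alpha$ and $J\alpha\ne\alpha$. Suppose that $M$ satisfies the axiom of strongly isotropic antiholomorphic 2-planes: for each point $p\in M$ and each strongly isotropic antiholomorphic 2-plane $\alpha\subset T_pM$ there is a totally geodesic submanifold $M'$ of $M$ containing $p$ such that $T_pM'=\alpha$ and all tangent spaces of $M'$ are strongly isotropic antiholomorphic 2-planes. (Totally geodesic means that $\nabla_XY$ is tangent to $M'$ along $M'$ whenever the vector fields $X,Y$ are.) Then $M$ is of constant holomorphic sectional curvature: there is a constant $c\in\mathbb{R}$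 such that for every $p\in M$ and every nondegenerate holomorphic 2-plane $\alpha\subset T_pM$ with basis $\{x,y\}$, $$K(\alpha)=\frac{g(R(x,y)y,x)}{g(x,x)\,g(y,y)-g(x,y)^2}=c,\qquad R(X,Y)=[\nabla_X,\nabla_Y]-\nabla_{[X,Y]}.$$ -/

import Mathlib

open scoped Manifold ContDiff Bundle

universe u v

/-- A smooth pseudo-Riemannian metric on a smooth manifold `M` modelled on `E`: a smooth field of
nondegenerate symmetric bilinear forms on the tangent spaces. -/
structure PseudoRiemannianMetric (E : Type v) [NormedAddCommGroup E] [NormedSpace ℝ E]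
    (M : Type u) [TopologicalSpace M] [ChartedSpace E M] [IsManifold 𝓘(ℝ, E) ∞ M] where
  inner (p : M) : TangentSpace 𝓘(ℝ, E) p →L[ℝ] TangentSpace 𝓘(ℝ, E) p →L[ℝ] ℝ
  symm (p : M) (v w : TangentSpace 𝓘(ℝ, E) p) : inner p v w = inner p w v
  nondegenerate (p : M) (v : TangentSpace 𝓘(ℝ, E) p) : (∀ w, inner p v w = 0) → v = 0
  contMDiff : ContMDiff 𝓘(ℝ, E) (𝓘(ℝ, E).prod 𝓘(ℝ, E →L[ℝ] E →L[ℝ] ℝ)) ∞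
    (fun p ↦ Bundle.TotalSpace.mk' (E →L[ℝ] E →L[ℝ] ℝ)
      (E := fun p : M ↦ TangentSpace 𝓘(ℝ, E) p →L[ℝ] TangentSpace 𝓘(ℝ, E) p →L[ℝ] ℝ) p (inner p))

namespace PseudoRiemannianMetric

variable {E : Type v} [NormedAddCommGroup E] [NormedSpace ℝ E]
  {M : Type u} [TopologicalSpace M] [ChartedSpace E M] [IsManifold 𝓘(ℝ, E) ∞ M]

/-- `g` has signature `(a, b)`: every tangent space has an orthonormal basis consisting of `a`
vectors of square `-1` and `b` vectors of square `1`. -/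
def HasSignature (g : PseudoRiemannianMetric E M) (a b : ℕ) : Prop :=
  ∀ p : M, ∃ e : Module.Basis (Fin a ⊕ Fin b) ℝ (TangentSpace 𝓘(ℝ, E) p),
    ∀ i j, g.inner p (e i) (e j) = if i = j then Sum.elim (fun _ ↦ -1) (fun _ ↦ 1) i else 0

/-- The right-hand side of the Koszul formula,
`½ (X g(Y,Z) + Y g(Z,X) - Z g(X,Y) + g([X,Y],Z) - g([Y,Z],X) + g([Z,X],Y))`. -/
noncomputable def koszul (g : PseudoRiemannianMetric E M)
    (X Y Z : ∀ p : M, TangentSpace 𝓘(ℝ, E) p) (p : M) : ℝ :=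
  (1 / 2) * (mvfderiv 𝓘(ℝ, E) (fun q ↦ g.inner q (Y q) (Z q)) p (X p)
    + mvfderiv 𝓘(ℝ, E) (fun q ↦ g.inner q (Z q) (X q)) p (Y p)
    - mvfderiv 𝓘(ℝ, E) (fun q ↦ g.inner q (X q) (Y q)) p (Z p)
    + g.inner p (VectorField.mlieBracket 𝓘(ℝ, E) X Y p) (Z p)
    - g.inner p (VectorField.mlieBracket 𝓘(ℝ, E) Y Z p) (X p)
    + g.inner p (VectorField.mlieBracket 𝓘(ℝ, E) Z X p) (Y p))

theorem mdifferentiableAt_inner (g : PseudoRiemannianMetric E M)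
    {Y Z : ∀ p : M, TangentSpace 𝓘(ℝ, E) p} {p : M}
    (hY : MDiffAt (T% Y) p) (hZ : MDiffAt (T% Z) p) :
    MDiffAt (fun q ↦ g.inner q (Y q) (Z q)) p := by
  have hg := (g.contMDiff.mdifferentiable (by simp)) p
  have := MDifferentiableAt.clm_bundle_apply₂ (F₁ := E) (F₂ := E) (F₃ := ℝ)
    (E₃ := Bundle.Trivial M ℝ) hg hY hZ
  exact ((mdifferentiableAt_totalSpace _ _).mp this).2

/-- Two tangent vectors agree if their products with all differentiable fields agree. -/
theorem ext_inner (g : PseudoRiemannianMetric E M) {p : M} {v w : TangentSpace 𝓘(ℝ, E) p}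
    (h : ∀ Z : ∀ p : M, TangentSpace 𝓘(ℝ, E) p, MDiffAt (T% Z) p →
      g.inner p v (Z p) = g.inner p w (Z p)) : v = w := by
  rw [← sub_eq_zero]
  refine g.nondegenerate p _ fun u ↦ ?_
  have := h _ (FiberBundle.mdifferentiableAt_extend 𝓘(ℝ, E) E u)
  simp_all

variable [FiniteDimensional ℝ E]

theorem koszul_tensorial_left (g : PseudoRiemannianMetric E M)
    {Y Z : ∀ p : M, TangentSpace 𝓘(ℝ, E) p} {p : M}
    (hY : MDiffAt (T% Y) p) (hZ : MDiffAt (T% Z) p) :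
    TensorialAt 𝓘(ℝ, E) E (fun X ↦ g.koszul X Y Z p) p where
  smul {f X} hf hX := by
    have : CompleteSpace E := FiniteDimensional.complete ℝ E
    have h1 : mvfderiv 𝓘(ℝ, E) (fun q ↦ g.inner q (Z q) ((f • X) q)) p
        = f p • mvfderiv 𝓘(ℝ, E) (fun q ↦ g.inner q (Z q) (X q)) p
          + g.inner p (Z p) (X p) • mvfderiv 𝓘(ℝ, E) f p := by
      rw [← mvfderiv_fun_mul hf (g.mdifferentiableAt_inner hZ hX)]
      simp
    have h2 : mvfderiv 𝓘(ℝ, E) (fun q ↦ g.inner q ((f • X) q) (Y q)) p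
        = f p • mvfderiv 𝓘(ℝ, E) (fun q ↦ g.inner q (X q) (Y q)) p
          + g.inner p (X p) (Y p) • mvfderiv 𝓘(ℝ, E) f p := by
      rw [← mvfderiv_fun_mul hf (g.mdifferentiableAt_inner hX hY)]
      simp
    simp only [koszul, h1, h2, VectorField.mlieBracket_smul_left hf hX,
      VectorField.mlieBracket_smul_right hf hX]
    simp [g.symm p (Z p) (X p)]
    ring
  add {X X'} hX hX' := by
    have : CompleteSpace E := FiniteDimensional.complete ℝ E
    have h1 : mvfderiv 𝓘(ℝ, E) (fun q ↦ g.inner q (Z q) ((X + X') q)) p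
        = mvfderiv 𝓘(ℝ, E) (fun q ↦ g.inner q (Z q) (X q)) p
          + mvfderiv 𝓘(ℝ, E) (fun q ↦ g.inner q (Z q) (X' q)) p := by
      rw [← mvfderiv_fun_add (g.mdifferentiableAt_inner hZ hX) (g.mdifferentiableAt_inner hZ hX')]
      simp
    have h2 : mvfderiv 𝓘(ℝ, E) (fun q ↦ g.inner q ((X + X') q) (Y q)) p
        = mvfderiv 𝓘(ℝ, E) (fun q ↦ g.inner q (X q) (Y q)) p
          + mvfderiv 𝓘(ℝ, E) (fun q ↦ g.inner q (X' q) (Y q)) p := by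
      rw [← mvfderiv_fun_add (g.mdifferentiableAt_inner hX hY) (g.mdifferentiableAt_inner hX' hY)]
      simp
    simp only [koszul, h1, h2, VectorField.mlieBracket_add_left hX hX',
      VectorField.mlieBracket_add_right hX hX']
    simp
    ring

theorem koszul_tensorial_right (g : PseudoRiemannianMetric E M)
    {X Y : ∀ p : M, TangentSpace 𝓘(ℝ, E) p} {p : M}
    (hX : MDiffAt (T% X) p) (hY : MDiffAt (T% Y) p) :
    TensorialAt 𝓘(ℝ, E) E (fun Z ↦ g.koszul X Y Z p) p where
  smul {f Z} hf hZ := by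
    have : CompleteSpace E := FiniteDimensional.complete ℝ E
    have h1 : mvfderiv 𝓘(ℝ, E) (fun q ↦ g.inner q (Y q) ((f • Z) q)) p
        = f p • mvfderiv 𝓘(ℝ, E) (fun q ↦ g.inner q (Y q) (Z q)) p
          + g.inner p (Y p) (Z p) • mvfderiv 𝓘(ℝ, E) f p := by
      rw [← mvfderiv_fun_mul hf (g.mdifferentiableAt_inner hY hZ)]
      simp
    have h2 : mvfderiv 𝓘(ℝ, E) (fun q ↦ g.inner q ((f • Z) q) (X q)) p
        = f p • mvfderiv 𝓘(ℝ, E) (fun q ↦ g.inner q (Z q) (X q)) p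
          + g.inner p (Z p) (X p) • mvfderiv 𝓘(ℝ, E) f p := by
      rw [← mvfderiv_fun_mul hf (g.mdifferentiableAt_inner hZ hX)]
      simp
    simp only [koszul, h1, h2, VectorField.mlieBracket_smul_left hf hZ,
      VectorField.mlieBracket_smul_right hf hZ]
    simp [g.symm p (Z p) (Y p)]
    ring
  add {Z Z'} hZ hZ' := by
    have : CompleteSpace E := FiniteDimensional.complete ℝ E
    have h1 : mvfderiv 𝓘(ℝ, E) (fun q ↦ g.inner q (Y q) ((Z + Z') q)) p
        = mvfderiv 𝓘(ℝ, E) (fun q ↦ g.inner q (Y q) (Z q)) p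
          + mvfderiv 𝓘(ℝ, E) (fun q ↦ g.inner q (Y q) (Z' q)) p := by
      rw [← mvfderiv_fun_add (g.mdifferentiableAt_inner hY hZ) (g.mdifferentiableAt_inner hY hZ')]
      simp
    have h2 : mvfderiv 𝓘(ℝ, E) (fun q ↦ g.inner q ((Z + Z') q) (X q)) p
        = mvfderiv 𝓘(ℝ, E) (fun q ↦ g.inner q (Z q) (X q)) p
          + mvfderiv 𝓘(ℝ, E) (fun q ↦ g.inner q (Z' q) (X q)) p := by
      rw [← mvfderiv_fun_add (g.mdifferentiableAt_inner hZ hX) (g.mdifferentiableAt_inner hZ' hX)]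
      simp
    simp only [koszul, h1, h2, VectorField.mlieBracket_add_left hZ hZ',
      VectorField.mlieBracket_add_right hZ hZ']
    simp
    ring

theorem bijective_inner (g : PseudoRiemannianMetric E M) (p : M) :
    Function.Bijective (g.inner p) := by
  have : FiniteDimensional ℝ (TangentSpace 𝓘(ℝ, E) p) := inferInstanceAs (FiniteDimensional ℝ E)
  have : T2Space (TangentSpace 𝓘(ℝ, E) p) := inferInstanceAs (T2Space E)
  have hinj : Function.Injective (g.inner p) := by
    refine (injective_iff_map_eq_zero (g.inner p)).2 fun v hv ↦ g.nondegenerate p v fun w ↦ ?_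
    simp [hv]
  refine ⟨hinj, ?_⟩
  have hrank : Module.finrank ℝ (TangentSpace 𝓘(ℝ, E) p)
      = Module.finrank ℝ (TangentSpace 𝓘(ℝ, E) p →L[ℝ] ℝ) := by
    rw [← (LinearMap.toContinuousLinearMap (𝕜 := ℝ) (E := TangentSpace 𝓘(ℝ, E) p)
      (F' := ℝ)).finrank_eq]
    exact Subspace.dual_finrank_eq.symm
  have : FiniteDimensional ℝ (TangentSpace 𝓘(ℝ, E) p →L[ℝ] ℝ) :=
    (LinearMap.toContinuousLinearMap (𝕜 := ℝ) (E := TangentSpace 𝓘(ℝ, E) p)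
      (F' := ℝ)).finiteDimensional
  exact (LinearMap.injective_iff_surjective_of_finrank_eq_finrank
    (f := (g.inner p).toLinearMap) hrank).1 hinj

/-- The musical isomorphism sending a covector `α` to the vector `v` with `g(v, ·) = α`. -/
noncomputable def sharp (g : PseudoRiemannianMetric E M) (p : M) :
    (TangentSpace 𝓘(ℝ, E) p →L[ℝ] ℝ) ≃ₗ[ℝ] TangentSpace 𝓘(ℝ, E) p :=
  (LinearEquiv.ofBijective (g.inner p).toLinearMap (g.bijective_inner p)).symm

theorem inner_sharp (g : PseudoRiemannianMetric E M) (p : M)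
    (α : TangentSpace 𝓘(ℝ, E) p →L[ℝ] ℝ) : g.inner p (g.sharp p α) = α :=
  (LinearEquiv.ofBijective (g.inner p).toLinearMap (g.bijective_inner p)).apply_symm_apply α

open scoped Classical in
/-- The covariant derivative `v ↦ ∇_v Y` at `p` of a vector field `Y` which is differentiable at
`p`, determined by the Koszul formula; the value is zero if `Y` is not differentiable at `p`. -/
noncomputable def leviCivitaFun (g : PseudoRiemannianMetric E M)
    (Y : ∀ p : M, TangentSpace 𝓘(ℝ, E) p) (p : M) :
    TangentSpace 𝓘(ℝ, E) p →L[ℝ] TangentSpace 𝓘(ℝ, E) p :=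
  if hY : MDiffAt (T% Y) p then
    have : FiniteDimensional ℝ (TangentSpace 𝓘(ℝ, E) p) := inferInstanceAs (FiniteDimensional ℝ E)
    have : T2Space (TangentSpace 𝓘(ℝ, E) p) := inferInstanceAs (T2Space E)
    LinearMap.toContinuousLinearMap ((g.sharp p).toLinearMap ∘ₗ
      (TensorialAt.mkHom₂ (fun X Z ↦ g.koszul X Y Z p) p
        (fun _ hZ ↦ g.koszul_tensorial_left hY hZ)
        (fun _ hX ↦ g.koszul_tensorial_right hX hY)).toLinearMap)
  else 0

theorem inner_leviCivitaFun (g : PseudoRiemannianMetric E M)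
    {X Y Z : ∀ p : M, TangentSpace 𝓘(ℝ, E) p} {p : M}
    (hX : MDiffAt (T% X) p) (hY : MDiffAt (T% Y) p) (hZ : MDiffAt (T% Z) p) :
    g.inner p (g.leviCivitaFun Y p (X p)) (Z p) = g.koszul X Y Z p := by
  rw [leviCivitaFun, dif_pos hY]
  have := TensorialAt.mkHom₂_apply (fun Z hZ ↦ g.koszul_tensorial_left (Z := Z) hY hZ)
    (fun X hX ↦ g.koszul_tensorial_right (X := X) hX hY) hX hZ
  exact (congrArg (fun α ↦ α (Z p)) (g.inner_sharp p _)).trans this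

/-- The Levi-Civita connection of `g`. -/
noncomputable def leviCivita (g : PseudoRiemannianMetric E M) :
    CovariantDerivative 𝓘(ℝ, E) E (TangentSpace 𝓘(ℝ, E) : M → Type v) where
  toFun := g.leviCivitaFun
  isCovariantDerivativeOnUniv :=
    { add := by
        intro Y Y' p hY hY' _
        have : CompleteSpace E := FiniteDimensional.complete ℝ E
        have hYY := mdifferentiableAt_add_section hY hY'
        ext v
        have hX := FiberBundle.mdifferentiableAt_extend 𝓘(ℝ, E) E v
        refine g.ext_inner fun Z hZ ↦ ?_
        have e := fun (Y : ∀ p : M, TangentSpace 𝓘(ℝ, E) p) (hY : MDiffAt (T% Y) p) ↦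
          g.inner_leviCivitaFun hX hY hZ
        simp only [FiberBundle.extend_apply_self] at e
        rw [add_apply, map_add, add_apply, e _ hYY, e _ hY, e _ hY']
        set X := FiberBundle.extend E v
        have h1 : mvfderiv 𝓘(ℝ, E) (fun q ↦ g.inner q ((Y + Y') q) (Z q)) p
            = mvfderiv 𝓘(ℝ, E) (fun q ↦ g.inner q (Y q) (Z q)) p
              + mvfderiv 𝓘(ℝ, E) (fun q ↦ g.inner q (Y' q) (Z q)) p := by
          rw [← mvfderiv_fun_add (g.mdifferentiableAt_inner hY hZ)
            (g.mdifferentiableAt_inner hY' hZ)]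
          simp
        have h2 : mvfderiv 𝓘(ℝ, E) (fun q ↦ g.inner q (X q) ((Y + Y') q)) p
            = mvfderiv 𝓘(ℝ, E) (fun q ↦ g.inner q (X q) (Y q)) p
              + mvfderiv 𝓘(ℝ, E) (fun q ↦ g.inner q (X q) (Y' q)) p := by
          rw [← mvfderiv_fun_add (g.mdifferentiableAt_inner hX hY)
            (g.mdifferentiableAt_inner hX hY')]
          simp
        simp only [koszul, h1, h2, VectorField.mlieBracket_add_left hY hY',
          VectorField.mlieBracket_add_right hY hY']
        simp
        ring
      leibniz := by
        intro Y f p hY hf _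
        have : CompleteSpace E := FiniteDimensional.complete ℝ E
        have hfY := hf.smul_section hY
        ext v
        have hX := FiberBundle.mdifferentiableAt_extend 𝓘(ℝ, E) E v
        refine g.ext_inner fun Z hZ ↦ ?_
        have e := fun (Y : ∀ p : M, TangentSpace 𝓘(ℝ, E) p) (hY : MDiffAt (T% Y) p) ↦
          g.inner_leviCivitaFun hX hY hZ
        simp only [FiberBundle.extend_apply_self] at e
        rw [add_apply, map_add, add_apply, e _ hfY]
        simp only [smul_apply, map_smul, e _ hY, ContinuousLinearMap.smulRight_apply]
        set X := FiberBundle.extend E v with hXdef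
        have hXp : X p = v := by simp [hXdef]
        have h1 : mvfderiv 𝓘(ℝ, E) (fun q ↦ g.inner q ((f • Y) q) (Z q)) p
            = f p • mvfderiv 𝓘(ℝ, E) (fun q ↦ g.inner q (Y q) (Z q)) p
              + g.inner p (Y p) (Z p) • mvfderiv 𝓘(ℝ, E) f p := by
          rw [← mvfderiv_fun_mul hf (g.mdifferentiableAt_inner hY hZ)]
          simp
        have h2 : mvfderiv 𝓘(ℝ, E) (fun q ↦ g.inner q (X q) ((f • Y) q)) p
            = f p • mvfderiv 𝓘(ℝ, E) (fun q ↦ g.inner q (X q) (Y q)) p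
              + g.inner p (X p) (Y p) • mvfderiv 𝓘(ℝ, E) f p := by
          rw [← mvfderiv_fun_mul hf (g.mdifferentiableAt_inner hX hY)]
          simp
        simp only [koszul, h1, h2, VectorField.mlieBracket_smul_left hf hY,
          VectorField.mlieBracket_smul_right hf hY]
        simp [hXp, g.symm p (Y p) v]
        ring }

/-- The Koszul formula. -/
theorem inner_leviCivita (g : PseudoRiemannianMetric E M)
    {X Y Z : ∀ p : M, TangentSpace 𝓘(ℝ, E) p} {p : M}
    (hX : MDiffAt (T% X) p) (hY : MDiffAt (T% Y) p) (hZ : MDiffAt (T% Z) p) :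
    g.inner p (g.leviCivita Y p (X p)) (Z p) = g.koszul X Y Z p :=
  g.inner_leviCivitaFun hX hY hZ

/-- The Levi-Civita connection is torsion-free. -/
theorem leviCivita_torsion (g : PseudoRiemannianMetric E M)
    {X Y : ∀ p : M, TangentSpace 𝓘(ℝ, E) p} {p : M}
    (hX : MDiffAt (T% X) p) (hY : MDiffAt (T% Y) p) :
    g.leviCivita Y p (X p) - g.leviCivita X p (Y p) = VectorField.mlieBracket 𝓘(ℝ, E) X Y p := by
  refine g.ext_inner fun Z hZ ↦ ?_
  rw [map_sub, sub_apply, g.inner_leviCivita hX hY hZ, g.inner_leviCivita hY hX hZ]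
  simp only [koszul, fun q ↦ g.symm q (Z q) (X q), fun q ↦ g.symm q (Y q) (X q),
    fun q ↦ g.symm q (Z q) (Y q), VectorField.mlieBracket_swap_apply (V := Y) (W := X),
    VectorField.mlieBracket_swap_apply (V := Z) (W := X),
    VectorField.mlieBracket_swap_apply (V := Z) (W := Y)]
  simp
  ring

/-- The Levi-Civita connection is compatible with the metric. -/
theorem leviCivita_metric (g : PseudoRiemannianMetric E M)
    {X Y Z : ∀ p : M, TangentSpace 𝓘(ℝ, E) p} {p : M}
    (hX : MDiffAt (T% X) p) (hY : MDiffAt (T% Y) p) (hZ : MDiffAt (T% Z) p) :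
    mvfderiv 𝓘(ℝ, E) (fun q ↦ g.inner q (Y q) (Z q)) p (X p)
      = g.inner p (g.leviCivita Y p (X p)) (Z p) + g.inner p (Y p) (g.leviCivita Z p (X p)) := by
  rw [g.symm p (Y p), g.inner_leviCivita hX hY hZ, g.inner_leviCivita hX hZ hY]
  simp only [koszul, fun q ↦ g.symm q (Z q) (X q), fun q ↦ g.symm q (Y q) (X q),
    fun q ↦ g.symm q (Z q) (Y q), VectorField.mlieBracket_swap_apply (V := Y) (W := X),
    VectorField.mlieBracket_swap_apply (V := Z) (W := X),
    VectorField.mlieBracket_swap_apply (V := Z) (W := Y)]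
  simp
  ring

/-- The curvature operator `R(X,Y)Z = ∇_X ∇_Y Z - ∇_Y ∇_X Z - ∇_[X,Y] Z` on vector fields. -/
noncomputable def curvatureField (g : PseudoRiemannianMetric E M)
    (X Y Z : ∀ p : M, TangentSpace 𝓘(ℝ, E) p) (p : M) : TangentSpace 𝓘(ℝ, E) p :=
  g.leviCivita (fun q ↦ g.leviCivita Z q (Y q)) p (X p)
    - g.leviCivita (fun q ↦ g.leviCivita Z q (X q)) p (Y p)
    - g.leviCivita Z p (VectorField.mlieBracket 𝓘(ℝ, E) X Y p)

/-- The curvature tensor `R(x,y,z,u) = g(R(x,y)z, u)` at `p`, computed with extensions of `x, y, z`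
to vector fields which are smooth near `p`. -/
noncomputable def curvature (g : PseudoRiemannianMetric E M) (p : M)
    (x y z u : TangentSpace 𝓘(ℝ, E) p) : ℝ :=
  g.inner p (g.curvatureField (FiberBundle.extend E x) (FiberBundle.extend E y)
    (FiberBundle.extend E z) p) u

/-- The sectional curvature of the nondegenerate plane with basis `x, y`. -/
noncomputable def sectionalCurvature (g : PseudoRiemannianMetric E M) (p : M)
    (x y : TangentSpace 𝓘(ℝ, E) p) : ℝ :=
  g.curvature p x y y x / (g.inner p x x * g.inner p y y - g.inner p x y ^ 2)

/-- `α` is a nondegenerate 2-plane: the restriction of `g` to `α` has rank 2. -/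
def IsNondegeneratePlane (g : PseudoRiemannianMetric E M) {p : M}
    (α : Submodule ℝ (TangentSpace 𝓘(ℝ, E) p)) : Prop :=
  Module.finrank ℝ α = 2 ∧ ∀ x ∈ α, (∀ y ∈ α, g.inner p x y = 0) → x = 0

/-- `α` is a strongly isotropic 2-plane: the restriction of `g` to `α` has rank 0. -/
def IsStronglyIsotropicPlane (g : PseudoRiemannianMetric E M) {p : M}
    (α : Submodule ℝ (TangentSpace 𝓘(ℝ, E) p)) : Prop :=
  Module.finrank ℝ α = 2 ∧ ∀ x ∈ α, ∀ y ∈ α, g.inner p x y = 0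

/-- The tangent space at `f q` of the (immersed) surface `f : N → M`. -/
noncomputable def tangentPlane {N : Type u} [TopologicalSpace N]
    [ChartedSpace (EuclideanSpace ℝ (Fin 2)) N] (f : N → M) (q : N) :
    Submodule ℝ (TangentSpace 𝓘(ℝ, E) (f q)) :=
  LinearMap.range (mfderiv (𝓡 2) 𝓘(ℝ, E) f q).toLinearMap

/-- The immersed surface `f : N → M` is totally geodesic: if a vector field `Y` of `M` is tangent to
the surface along the surface, then so is `∇_v Y` for every vector `v` tangent to the surface. -/
def IsTotallyGeodesic (g : PseudoRiemannianMetric E M) {N : Type u} [TopologicalSpace N]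
    [ChartedSpace (EuclideanSpace ℝ (Fin 2)) N] (f : N → M) : Prop :=
  ∀ (q : N) (Y : ∀ p : M, TangentSpace 𝓘(ℝ, E) p), MDiffAt (T% Y) (f q) →
    (∀ᶠ r in nhds q, Y (f r) ∈ tangentPlane (E := E) f r) →
    ∀ v ∈ tangentPlane (E := E) f q, g.leviCivita Y (f q) v ∈ tangentPlane (E := E) f q

end PseudoRiemannianMetric

/-- An almost Hermitian structure of indefinite metric: a pseudo-Riemannian metric `g` and a smooth
almost complex structure `J` with `g(Jx, Jy) = g(x, y)`. -/
structure AlmostHermitianStructure (E : Type v) [NormedAddCommGroup E] [NormedSpace ℝ E]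
    (M : Type u) [TopologicalSpace M] [ChartedSpace E M] [IsManifold 𝓘(ℝ, E) ∞ M]
    extends PseudoRiemannianMetric E M where
  J (p : M) : TangentSpace 𝓘(ℝ, E) p →L[ℝ] TangentSpace 𝓘(ℝ, E) p
  J_J (p : M) (x : TangentSpace 𝓘(ℝ, E) p) : J p (J p x) = -x
  inner_J_J (p : M) (x y : TangentSpace 𝓘(ℝ, E) p) : inner p (J p x) (J p y) = inner p x y
  contMDiff_J : ContMDiff 𝓘(ℝ, E) (𝓘(ℝ, E).prod 𝓘(ℝ, E →L[ℝ] E)) ∞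
    (fun p ↦ Bundle.TotalSpace.mk' (E →L[ℝ] E)
      (E := fun p : M ↦ TangentSpace 𝓘(ℝ, E) p →L[ℝ] TangentSpace 𝓘(ℝ, E) p) p (J p))

namespace AlmostHermitianStructure

variable {E : Type v} [NormedAddCommGroup E] [NormedSpace ℝ E]
  {M : Type u} [TopologicalSpace M] [ChartedSpace E M] [IsManifold 𝓘(ℝ, E) ∞ M]

/-- `α` is a holomorphic 2-plane: `Jα = α`. -/
def IsHolomorphicPlane (h : AlmostHermitianStructure E M) {p : M}
    (α : Submodule ℝ (TangentSpace 𝓘(ℝ, E) p)) : Prop :=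
  Module.finrank ℝ α = 2 ∧ α.map (h.J p).toLinearMap = α

/-- `α` is an antiholomorphic 2-plane: `Jα ⟂ α` and `Jα ≠ α`. -/
def IsAntiholomorphicPlane (h : AlmostHermitianStructure E M) {p : M}
    (α : Submodule ℝ (TangentSpace 𝓘(ℝ, E) p)) : Prop :=
  Module.finrank ℝ α = 2 ∧ (∀ x ∈ α, ∀ y ∈ α, h.inner p (h.J p x) y = 0) ∧
    α.map (h.J p).toLinearMap ≠ α

variable [FiniteDimensional ℝ E]

/-- The structure is Kähler: `∇J = 0`, i.e. `∇_v (JY) = J ∇_v Y` for all `v` and `Y`. -/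
def IsKaehler (h : AlmostHermitianStructure E M) : Prop :=
  ∀ (p : M) (Y : ∀ p : M, TangentSpace 𝓘(ℝ, E) p), MDiffAt (T% Y) p →
    ∀ v : TangentSpace 𝓘(ℝ, E) p,
      h.leviCivita (fun q ↦ h.J q (Y q)) p v = h.J p (h.leviCivita Y p v)

/-- The plane condition for strongly isotropic antiholomorphic planes: every such plane `α` at every
point `p` is the tangent space at `p` of a totally geodesic submanifold through `p` all of whose
tangent spaces are strongly isotropic antiholomorphic planes. -/
def SatisfiesStronglyIsotropicAntiholomorphicPlaneAxiom (h : AlmostHermitianStructure E M) :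
    Prop :=
  ∀ (p : M) (α : Submodule ℝ (TangentSpace 𝓘(ℝ, E) p)),
    h.IsStronglyIsotropicPlane α → h.IsAntiholomorphicPlane α →
    ∃ (N : Type u) (_ : TopologicalSpace N) (_ : ChartedSpace (EuclideanSpace ℝ (Fin 2)) N)
      (_ : IsManifold (𝓡 2) ∞ N) (f : N → M),
      Function.Injective f ∧ Manifold.IsImmersion (𝓡 2) 𝓘(ℝ, E) ∞ f ∧
      h.IsTotallyGeodesic f ∧
      (∃ (q : N) (hq : f q = p), hq ▸ PseudoRiemannianMetric.tangentPlane (E := E) f q = α) ∧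
      ∀ q : N, h.IsStronglyIsotropicPlane (PseudoRiemannianMetric.tangentPlane (E := E) f q) ∧
        h.IsAntiholomorphicPlane (PseudoRiemannianMetric.tangentPlane (E := E) f q)

/-- Constant holomorphic sectional curvature: all nondegenerate holomorphic 2-planes at all points
have the same sectional curvature `c`. -/
def HasConstantHolomorphicSectionalCurvature (h : AlmostHermitianStructure E M) : Prop :=
  ∃ c : ℝ, ∀ (p : M) (x y : TangentSpace 𝓘(ℝ, E) p),
    h.IsNondegeneratePlane (Submodule.span ℝ {x, y}) →
    h.IsHolomorphicPlane (Submodule.span ℝ {x, y}) →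
    h.sectionalCurvature p x y = c

end AlmostHermitianStructure

/-! A totally geodesic surface has curvature-invariant tangent planes, so the axiom gives
g(R(x,y)y,w) = 0 whenever x, y span a strongly isotropic antiholomorphic plane and w is orthogonal
to it (`vanishesOnIsotropicPlanes`). From there on the pointwise argument is linear algebra on
Kähler curvature tensors.

Write H(v) = R(v,Jv,Jv,v) and take null vectors x, y spanning a totally isotropic complex plane,
with dual null vectors x', y'. The plane of x + Jy and y is again admissible. Testing it against
itself gives H(y) = 0; testing it against x' - Jy' gives R(x,y,y,x') = R(y,Jy,Jy,y'). Since H(y) = 0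
holds in every such frame, it can be polarised: moving y towards x gives R(y,Jy,Jy,x) = 0, and then
moving y towards x' (with x moving towards -y') gives 3 R(y,Jy,Jy,y') = 0
(`IsHyperbolicFrame.holomorphic_dual_eq_zero`).

For y = e ± f with e, f complex-orthogonal unit vectors of opposite sign, this says H(e) = H(f)
(`holomorphic_eq_of_orthonormal`). Two positive unit vectors have a common complex-orthogonal
negative unit vector, so H is constant on positive unit vectors. Subtracting a multiple of the model
tensor makes H vanish on the open cone of positive vectors. Being quartic, H then vanishes
everywhere, and a Kähler curvature tensor with H = 0 is zero (`IsKaehlerCurvature.exists_eq_model`).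

Thus R = c(p) times the model tensor at each point. The second Bianchi identity forces dc = 0
(`IsKaehler.schur`), and connectedness makes c constant. The differential-geometric groundwork
establishes smoothness of the connection, tensoriality and symmetries of R, and both Bianchi
identities. -/

open Filter Topology VectorField

/-! ### Functions and vector fields smooth near a point -/

section SmoothFun

variable {E : Type v} [NormedAddCommGroup E] [NormedSpace ℝ E]
  {M : Type u} [TopologicalSpace M] [ChartedSpace E M]

variable (E) in
/-- The function `f` is smooth in a neighbourhood of `p`. -/
def SmoothFunNear (f : M → ℝ) (p : M) : Prop :=
  ∀ᶠ q in 𝓝 p, ContMDiffAt 𝓘(ℝ, E) 𝓘(ℝ, ℝ) ∞ f q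

variable {f k : M → ℝ} {p : M}

theorem SmoothFunNear.contMDiffAt (h : SmoothFunNear E f p) :
    ContMDiffAt 𝓘(ℝ, E) 𝓘(ℝ, ℝ) ∞ f p :=
  h.self_of_nhds

theorem SmoothFunNear.mdiffAt (h : SmoothFunNear E f p) :
    MDifferentiableAt 𝓘(ℝ, E) 𝓘(ℝ, ℝ) f p :=
  h.contMDiffAt.mdifferentiableAt (by simp)

theorem SmoothFunNear.eventually (h : SmoothFunNear E f p) :
    ∀ᶠ q in 𝓝 p, SmoothFunNear E f q :=
  eventually_eventually_nhds.2 h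

theorem SmoothFunNear.const (c : ℝ) : SmoothFunNear E (fun _ : M ↦ c) p :=
  Eventually.of_forall fun _ ↦ contMDiffAt_const

theorem SmoothFunNear.mul (hf : SmoothFunNear E f p) (hk : SmoothFunNear E k p) :
    SmoothFunNear E (fun q ↦ f q * k q) p := by
  filter_upwards [hf, hk] with q h1 h2 using h1.mul h2

theorem SmoothFunNear.add (hf : SmoothFunNear E f p) (hk : SmoothFunNear E k p) :
    SmoothFunNear E (fun q ↦ f q + k q) p := by
  filter_upwards [hf, hk] with q h1 h2 using h1.add h2

theorem SmoothFunNear.sub (hf : SmoothFunNear E f p) (hk : SmoothFunNear E k p) :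
    SmoothFunNear E (fun q ↦ f q - k q) p := by
  filter_upwards [hf, hk] with q h1 h2 using h1.sub h2

theorem SmoothFunNear.congr (hf : SmoothFunNear E f p) (hk : ∀ᶠ q in 𝓝 p, k q = f q) :
    SmoothFunNear E k p := by
  filter_upwards [hf, hk.eventually_nhds] with q h1 h2 using h1.congr_of_eventuallyEq h2

end SmoothFun

section SmoothField

variable {E : Type v} [NormedAddCommGroup E] [NormedSpace ℝ E]
  {M : Type u} [TopologicalSpace M] [ChartedSpace E M] [IsManifold 𝓘(ℝ, E) ∞ M]

/-- The vector field `X` is smooth in a neighbourhood of `p`. -/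
def SmoothFieldNear (X : ∀ p : M, TangentSpace 𝓘(ℝ, E) p) (p : M) : Prop :=
  ∀ᶠ q in 𝓝 p, CMDiffAt ∞ (T% X) q

variable {X Y Z : ∀ p : M, TangentSpace 𝓘(ℝ, E) p} {f k : M → ℝ} {p : M}

theorem SmoothFieldNear.contMDiffAt (h : SmoothFieldNear X p) : CMDiffAt ∞ (T% X) p :=
  h.self_of_nhds

theorem SmoothFieldNear.mdiffAt (h : SmoothFieldNear X p) : MDiffAt (T% X) p :=
  h.contMDiffAt.mdifferentiableAt (by simp)

theorem SmoothFieldNear.eventually (h : SmoothFieldNear X p) :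
    ∀ᶠ q in 𝓝 p, SmoothFieldNear X q :=
  eventually_eventually_nhds.2 h

theorem SmoothFieldNear.congr (h : SmoothFieldNear X p) (hXY : ∀ᶠ q in 𝓝 p, Y q = X q) :
    SmoothFieldNear Y p := by
  filter_upwards [h, hXY.eventually_nhds] with q hq hq'
  refine hq.congr_of_eventuallyEq ?_
  filter_upwards [hq'] with r hr
  rw [hr]

theorem SmoothFieldNear.add (hX : SmoothFieldNear X p) (hY : SmoothFieldNear Y p) :
    SmoothFieldNear (X + Y) p := by
  filter_upwards [hX, hY] with q h1 h2 using h1.add_section h2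

theorem SmoothFieldNear.sub (hX : SmoothFieldNear X p) (hY : SmoothFieldNear Y p) :
    SmoothFieldNear (X - Y) p := by
  filter_upwards [hX, hY] with q h1 h2 using h1.sub_section h2

theorem SmoothFieldNear.smul (hf : SmoothFunNear E f p) (hX : SmoothFieldNear X p) :
    SmoothFieldNear (f • X) p := by
  filter_upwards [hf, hX] with q h1 h2 using h1.smul_section h2

theorem SmoothFieldNear.const_smul (c : ℝ) (hX : SmoothFieldNear X p) :
    SmoothFieldNear (c • X) p :=
  SmoothFieldNear.smul (SmoothFunNear.const c) hX

theorem smoothFieldNear_extend (v : TangentSpace 𝓘(ℝ, E) p) :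
    SmoothFieldNear (FiberBundle.extend E v) p := by
  obtain ⟨s, hs, h⟩ := FiberBundle.exists_contMDiffOn_extend (k := ∞) 𝓘(ℝ, E) E v
  filter_upwards [eventually_mem_nhds_iff.2 hs] with q hq using h.contMDiffAt hq

theorem smoothFieldNear_mlieBracket [CompleteSpace E] (hX : SmoothFieldNear X p)
    (hY : SmoothFieldNear Y p) : SmoothFieldNear (mlieBracket 𝓘(ℝ, E) X Y) p := by
  have : IsManifold 𝓘(ℝ, E) (minSmoothness ℝ 2) M :=
    IsManifold.of_le (n := ∞) (by simpa using ENat.LEInfty.out)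
  have : IsManifold 𝓘(ℝ, E) (((⊤ : ℕ∞) : ℕ∞ω) + 1) M := by simpa
  filter_upwards [hX, hY] with q h1 h2
  exact ContMDiffAt.mlieBracket_vectorField (n := ⊤) (m := ⊤) h1 h2 (by simp)

/-- The differential is a smooth section of a bundle of linear maps; applying it to a smooth field
gives a smooth section of the tangent bundle of ℝ, whose fibre part is the derivative. -/
theorem SmoothFunNear.mvfderiv_apply (hf : SmoothFunNear E f p) (hX : SmoothFieldNear X p) :
    SmoothFunNear E (fun q ↦ mvfderiv 𝓘(ℝ, E) f q (X q)) p := by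
  filter_upwards [hf, hX] with q h1 h2
  have h3 : ContMDiffAt 𝓘(ℝ, E) 𝓘(ℝ, ℝ).tangent ∞
      (fun r ↦ (⟨f r, mfderiv 𝓘(ℝ, E) 𝓘(ℝ, ℝ) f r (X r)⟩ : TangentBundle 𝓘(ℝ, ℝ) ℝ)) q := by
    refine ContMDiffAt.clm_apply_of_inCoordinates (b₁ := id) (b₂ := f) (v := X)
      (ϕ := fun r ↦ mfderiv 𝓘(ℝ, E) 𝓘(ℝ, ℝ) f r) ?_ h2 h1
    exact h1.mfderiv_const (m := ∞) (by simp)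
  rw [Bundle.contMDiffAt_totalSpace] at h3
  simpa only [trivializationAt_model_space_apply] using! h3.2

end SmoothField

/-! ### Smoothness of covariant derivatives -/

namespace PseudoRiemannianMetric

variable {E : Type v} [NormedAddCommGroup E] [NormedSpace ℝ E]
  {M : Type u} [TopologicalSpace M] [ChartedSpace E M] [IsManifold 𝓘(ℝ, E) ∞ M]
  {X Y Z : ∀ p : M, TangentSpace 𝓘(ℝ, E) p} {p : M}

theorem contMDiffAt_inner (g : PseudoRiemannianMetric E M) (hX : CMDiffAt ∞ (T% X) p)
    (hY : CMDiffAt ∞ (T% Y) p) :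
    ContMDiffAt 𝓘(ℝ, E) 𝓘(ℝ, ℝ) ∞ (fun q ↦ g.inner q (X q) (Y q)) p := by
  have := ContMDiffAt.clm_bundle_apply₂ (F₁ := E) (F₂ := E) (F₃ := ℝ)
    (E₃ := Bundle.Trivial M ℝ) (g.contMDiff p) hX hY
  exact ((Bundle.contMDiffAt_totalSpace).mp this).2

theorem smoothFunNear_inner (g : PseudoRiemannianMetric E M) (hX : SmoothFieldNear X p)
    (hY : SmoothFieldNear Y p) : SmoothFunNear E (fun q ↦ g.inner q (X q) (Y q)) p := by
  filter_upwards [hX, hY] with q h1 h2 using g.contMDiffAt_inner h1 h2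

variable [FiniteDimensional ℝ E]

theorem smoothFunNear_koszul (g : PseudoRiemannianMetric E M) (hX : SmoothFieldNear X p)
    (hY : SmoothFieldNear Y p) (hZ : SmoothFieldNear Z p) :
    SmoothFunNear E (g.koszul X Y Z) p := by
  have : CompleteSpace E := FiniteDimensional.complete ℝ E
  unfold koszul
  refine (SmoothFunNear.const (1 / 2)).mul ?_
  refine (((((?_ : SmoothFunNear E _ p).add ?_).sub ?_).add ?_).sub ?_).add ?_
  · exact (g.smoothFunNear_inner hY hZ).mvfderiv_apply hX
  · exact (g.smoothFunNear_inner hZ hX).mvfderiv_apply hY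
  · exact (g.smoothFunNear_inner hX hY).mvfderiv_apply hZ
  · exact g.smoothFunNear_inner (smoothFieldNear_mlieBracket hX hY) hZ
  · exact g.smoothFunNear_inner (smoothFieldNear_mlieBracket hY hZ) hX
  · exact g.smoothFunNear_inner (smoothFieldNear_mlieBracket hZ hX) hY

/-- A vector field is smooth if its products with smooth fields are. -/
theorem contMDiffAt_of_inner (g : PseudoRiemannianMetric E M)
    (h : ∀ v : TangentSpace 𝓘(ℝ, E) p, ContMDiffAt 𝓘(ℝ, E) 𝓘(ℝ, ℝ) ∞
      (fun q ↦ g.inner q (X q) (FiberBundle.extend E v q)) p) :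
    CMDiffAt ∞ (T% X) p := by
  have : CompleteSpace E := FiniteDimensional.complete ℝ E
  have : FiniteDimensional ℝ (E →L[ℝ] ℝ) :=
    (LinearMap.toContinuousLinearMap (𝕜 := ℝ) (E := E) (F' := ℝ)).finiteDimensional
  set t := trivializationAt E (TangentSpace 𝓘(ℝ, E) : M → Type v) p with ht
  have hp : p ∈ t.baseSet := FiberBundle.mem_baseSet_trivializationAt' p
  let b := Module.finBasis ℝ E
  let e : Fin (Module.finrank ℝ E) → ∀ q : M, TangentSpace 𝓘(ℝ, E) q := fun i ↦
    FiberBundle.extend E (t.symm p (b i))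
  have he : ∀ i q, e i q = t.symm q (b i) := by
    intro i q
    simp [e, FiberBundle.extend, ← ht, hp]
  let c : Fin (Module.finrank ℝ E) → E →L[ℝ] ℝ := fun i ↦
    LinearMap.toContinuousLinearMap (b.coord i)
  have hc : ∀ u : E, ∑ i, c i u • b i = u := fun u ↦ by simp [c]
  -- `G` is the metric and `a` the covector g(X, ·), both written in the trivialisation at `p`. The
  -- field is recovered there as `G⁻¹ a`, so it is smooth because inversion is smooth at invertible
  -- maps.
  let G : M → E →L[ℝ] E →L[ℝ] ℝ := fun q ↦
    ∑ i, ∑ j, g.inner q (e i q) (e j q) • (c i).smulRight (c j)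
  let a : M → E →L[ℝ] ℝ := fun q ↦ ∑ j, g.inner q (X q) (e j q) • c j
  have hsum : ∀ q ∈ t.baseSet, ∀ u : E, t.symm q u = ∑ i, c i u • e i q := by
    intro q hq u
    have h1 : t.symm q u = t.symmL ℝ q (∑ i, c i u • b i) := by
      rw [hc, t.symmL_apply hq]
    rw [h1, map_sum]
    refine Finset.sum_congr rfl fun i _ ↦ ?_
    rw [map_smul, he, t.symmL_apply hq]
  have hG : ∀ q ∈ t.baseSet, ∀ u w : E, G q u w = g.inner q (t.symm q u) (t.symm q w) := by
    intro q hq u w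
    rw [hsum q hq u, hsum q hq w]
    simp only [G, map_sum, map_smul, sum_apply, smul_apply,
      ContinuousLinearMap.smulRight_apply, smul_eq_mul, Finset.mul_sum]
    rw [Finset.sum_comm]
    refine Finset.sum_congr rfl fun i _ ↦ Finset.sum_congr rfl fun j _ ↦ ?_
    ring
  have ha : ∀ q ∈ t.baseSet, ∀ w : E, a q w = g.inner q (X q) (t.symm q w) := by
    intro q hq w
    rw [hsum q hq w]
    simp only [a, map_sum, map_smul, sum_apply, smul_apply, smul_eq_mul]
    refine Finset.sum_congr rfl fun i _ ↦ ?_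
    ring
  let L : ∀ q ∈ t.baseSet, E ≃L[ℝ] TangentSpace 𝓘(ℝ, E) q := fun q hq ↦
    (t.continuousLinearEquivAt ℝ q hq).symm
  have hinj : ∀ q ∈ t.baseSet, Function.Injective (G q) := by
    intro q hq
    refine (injective_iff_map_eq_zero (G q)).2 fun u hu ↦ ?_
    have h0 : t.symm q u = 0 := g.nondegenerate q _ fun w ↦ by
      have := hG q hq u (L q hq |>.symm w)
      rw [hu] at this
      have h2 : t.symm q ((L q hq).symm w) = w := (L q hq).apply_symm_apply w
      rw [h2] at this
      simpa using this.symm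
    exact (L q hq).injective (h0.trans (map_zero (L q hq)).symm)
  have hfin : Module.finrank ℝ E = Module.finrank ℝ (E →L[ℝ] ℝ) := by
    rw [← (LinearMap.toContinuousLinearMap (𝕜 := ℝ) (E := E) (F' := ℝ)).finrank_eq]
    exact Subspace.dual_finrank_eq.symm
  have hinv : ∀ q ∈ t.baseSet, ∃ A : E ≃L[ℝ] (E →L[ℝ] ℝ), (A : E →L[ℝ] E →L[ℝ] ℝ) = G q := by
    intro q hq
    refine ⟨(LinearEquiv.ofInjectiveOfFinrankEq (G q).toLinearMap (hinj q hq)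
      hfin).toContinuousLinearEquiv, ?_⟩
    ext; rfl
  have hGs : ContMDiffAt 𝓘(ℝ, E) 𝓘(ℝ, E →L[ℝ] E →L[ℝ] ℝ) ∞ G p := by
    refine ContMDiffAt.sum fun i _ ↦ ContMDiffAt.sum fun j _ ↦ ?_
    have h1 : ContMDiffAt 𝓘(ℝ, E) 𝓘(ℝ, ℝ) ∞ (fun q ↦ g.inner q (e i q) (e j q)) p :=
      g.contMDiffAt_inner (smoothFieldNear_extend _).contMDiffAt
        (smoothFieldNear_extend _).contMDiffAt
    exact h1.smul (contMDiffAt_const (I' := 𝓘(ℝ, E →L[ℝ] E →L[ℝ] ℝ)))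
  have has : ContMDiffAt 𝓘(ℝ, E) 𝓘(ℝ, E →L[ℝ] ℝ) ∞ a p := by
    refine ContMDiffAt.sum fun i _ ↦ ?_
    exact ContMDiffAt.smul (f := fun q ↦ g.inner q (X q) (e i q)) (g := fun _ ↦ c i) (h _)
      contMDiffAt_const
  have hGi : ContMDiffAt 𝓘(ℝ, E) 𝓘(ℝ, (E →L[ℝ] ℝ) →L[ℝ] E) ∞
      (fun q ↦ ContinuousLinearMap.inverse (G q)) p := by
    obtain ⟨A, hA⟩ := hinv p hp
    have h1 : ContDiffAt ℝ ∞ ContinuousLinearMap.inverse (G p) := hA ▸ contDiffAt_map_inverse A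
    exact h1.contMDiffAt.comp p hGs
  have hfinal : ContMDiffAt 𝓘(ℝ, E) 𝓘(ℝ, E) ∞
      (fun q ↦ ContinuousLinearMap.inverse (G q) (a q)) p := hGi.clm_apply has
  rw [t.contMDiffAt_section_iff hp]
  refine hfinal.congr_of_eventuallyEq ?_
  filter_upwards [t.open_baseSet.mem_nhds hp] with q hq
  obtain ⟨A, hA⟩ := hinv q hq
  have hX : t.symm q (t ⟨q, X q⟩).2 = X q := by simp [hq]
  have h1 : a q = A (t ⟨q, X q⟩).2 := by
    change _ = (A : E →L[ℝ] E →L[ℝ] ℝ) _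
    ext w
    rw [ha q hq, hA, hG q hq, hX]
  rw [h1, ← hA, ContinuousLinearMap.inverse_equiv]
  simp

/-- The products of ∇_X Y with smooth test fields are given by the Koszul expression, which is
smooth; nondegeneracy then transfers smoothness to the field itself. -/
theorem smoothFieldNear_leviCivita (g : PseudoRiemannianMetric E M) (hX : SmoothFieldNear X p)
    (hY : SmoothFieldNear Y p) : SmoothFieldNear (fun q ↦ g.leviCivita Y q (X q)) p := by
  filter_upwards [hX.eventually, hY.eventually] with q h1 h2
  refine g.contMDiffAt_of_inner fun v ↦ ?_
  have hv := smoothFieldNear_extend v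
  refine (g.smoothFunNear_koszul h1 h2 hv).contMDiffAt.congr_of_eventuallyEq ?_
  filter_upwards [h1.eventually, h2.eventually, hv.eventually] with r h3 h4 h5
  exact g.inner_leviCivita h3.mdiffAt h4.mdiffAt h5.mdiffAt

end PseudoRiemannianMetric

/-! ### Lie brackets and the algebraic symmetries they imply -/

/-- The Lie bracket acts on functions as the commutator of derivations. -/
theorem mvfderiv_mlieBracket {E : Type v} [NormedAddCommGroup E] [NormedSpace ℝ E]
    {M : Type u} [TopologicalSpace M] [ChartedSpace E M] [IsManifold 𝓘(ℝ, E) ∞ M]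
    [CompleteSpace E] {X Y : ∀ p : M, TangentSpace 𝓘(ℝ, E) p} {f : M → ℝ} {p : M}
    (hX : SmoothFieldNear X p) (hY : SmoothFieldNear Y p) (hf : SmoothFunNear E f p) :
    mvfderiv 𝓘(ℝ, E) f p (mlieBracket 𝓘(ℝ, E) X Y p)
      = mvfderiv 𝓘(ℝ, E) (fun q ↦ mvfderiv 𝓘(ℝ, E) f q (Y q)) p (X p)
        - mvfderiv 𝓘(ℝ, E) (fun q ↦ mvfderiv 𝓘(ℝ, E) f q (X q)) p (Y p) := by
  by_cases hE : ∀ v : E, v = 0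
  · have h0 : ∀ v : TangentSpace 𝓘(ℝ, E) p, v = 0 := hE
    rw [h0 (X p), h0 (Y p), h0 (mlieBracket 𝓘(ℝ, E) X Y p)]
    simp
  push Not at hE
  obtain ⟨v, hv⟩ := hE
  have : IsManifold 𝓘(ℝ, E) (minSmoothness ℝ 3) M :=
    IsManifold.of_le (n := ∞) (by simpa using ENat.LEInfty.out)
  -- The Jacobi identity for X, Y and fZ, compared with f times the one for X, Y and Z, leaves the
  -- desired scalar identity multiplied by Z. Hence Z must not vanish at `p`, and the
  -- zero-dimensional case was treated separately.
  set Z := FiberBundle.extend E (show TangentSpace 𝓘(ℝ, E) p from v) with hZdef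
  have hZ : SmoothFieldNear Z p := smoothFieldNear_extend _
  have hZp : Z p ≠ 0 := by rw [hZdef, FiberBundle.extend_apply_self]; exact hv
  have hc : ∀ {V : ∀ p : M, TangentSpace 𝓘(ℝ, E) p}, SmoothFieldNear V p →
      CMDiffAt (minSmoothness ℝ 2) (T% V) p := fun h ↦
    h.contMDiffAt.of_le (by simpa using ENat.LEInfty.out)
  have key := leibniz_identity_mlieBracket_apply (hc hX) (hc hY)
    (hc (SmoothFieldNear.smul hf hZ))
  have key0 := leibniz_identity_mlieBracket_apply (hc hX) (hc hY) (hc hZ)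
  have br : ∀ {V : ∀ p : M, TangentSpace 𝓘(ℝ, E) p},
      ∀ᶠ q in 𝓝 p, mlieBracket 𝓘(ℝ, E) V (f • Z) q
        = ((fun q ↦ mvfderiv 𝓘(ℝ, E) f q (V q)) • Z + f • mlieBracket 𝓘(ℝ, E) V Z) q := by
    intro V
    filter_upwards [hf.eventually, hZ.eventually] with q h1 h2
    rw [mlieBracket_smul_right h1.mdiffAt h2.mdiffAt]
    rfl
  have br2 : ∀ {U V : ∀ p : M, TangentSpace 𝓘(ℝ, E) p}, SmoothFieldNear V p →
      mlieBracket 𝓘(ℝ, E) U (mlieBracket 𝓘(ℝ, E) V (f • Z)) p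
        = mvfderiv 𝓘(ℝ, E) (fun q ↦ mvfderiv 𝓘(ℝ, E) f q (V q)) p (U p) • Z p
          + mvfderiv 𝓘(ℝ, E) f p (V p) • mlieBracket 𝓘(ℝ, E) U Z p
          + (mvfderiv 𝓘(ℝ, E) f p (U p) • mlieBracket 𝓘(ℝ, E) V Z p
          + f p • mlieBracket 𝓘(ℝ, E) U (mlieBracket 𝓘(ℝ, E) V Z) p) := by
    intro U V hV
    have h1 := hf.mvfderiv_apply hV
    have h2 := smoothFieldNear_mlieBracket hV hZ
    rw [Filter.EventuallyEq.mlieBracket_vectorField_eq (EventuallyEq.refl _ U) br,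
      mlieBracket_add_right (SmoothFieldNear.smul h1 hZ).mdiffAt
        (SmoothFieldNear.smul hf h2).mdiffAt,
      mlieBracket_smul_right h1.mdiffAt hZ.mdiffAt, mlieBracket_smul_right hf.mdiffAt h2.mdiffAt]
  rw [br2 hY, br2 hX, mlieBracket_smul_right hf.mdiffAt hZ.mdiffAt, key0] at key
  have : (mvfderiv 𝓘(ℝ, E) f p (mlieBracket 𝓘(ℝ, E) X Y p)
      - (mvfderiv 𝓘(ℝ, E) (fun q ↦ mvfderiv 𝓘(ℝ, E) f q (Y q)) p (X p)
        - mvfderiv 𝓘(ℝ, E) (fun q ↦ mvfderiv 𝓘(ℝ, E) f q (X q)) p (Y p))) • Z p = 0 := by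
    rw [← sub_eq_zero] at key
    rw [← neg_eq_zero, ← key]
    module
  rcases smul_eq_zero.1 this with h | h
  · linarith
  · exact absurd h hZp

/-- The symmetry `R(x,y,z,w) = R(z,w,x,y)` follows from the antisymmetries and the first Bianchi
identity. -/
theorem pair_symm_of_bianchi {T : Type*} (r : T → T → T → T → ℝ)
    (h₁ : ∀ x y z w, r x y z w = -r y x z w) (h₂ : ∀ x y z w, r x y z w = -r x y w z)
    (hb : ∀ x y z w, r x y z w + r y z x w + r z x y w = 0) (x y z w : T) :
    r x y z w = r z w x y := by
  linarith [hb x y z w, hb y z w x, hb z w x y, hb w x y z, h₁ x y z w, h₁ y z w x, h₁ z w x y,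
    h₁ w x y z, h₂ x y z w, h₂ y z w x, h₂ z w x y, h₂ w x y z, h₁ x z y w, h₁ z x y w,
    h₁ y w z x, h₁ w y z x, h₂ x z y w, h₂ z x y w, h₂ y w z x, h₂ w y z x, h₂ y z x w,
    h₂ z w y x, h₂ w x z y, h₁ z y x w, h₁ x w z y, h₂ x y w z, h₂ w z y x, h₁ y x w z,
    h₁ y z x w, h₁ z w y x, h₁ w x z y]

section

variable {E : Type v} [NormedAddCommGroup E] [NormedSpace ℝ E]
  {M : Type u} [TopologicalSpace M] [ChartedSpace E M]

theorem Filter.EventuallyEq.mvfderiv_apply_eq {f k : M → ℝ} {p : M} (h : f =ᶠ[𝓝 p] k)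
    (v : TangentSpace 𝓘(ℝ, E) p) : mvfderiv 𝓘(ℝ, E) f p v = mvfderiv 𝓘(ℝ, E) k p v :=
  DFunLike.congr_fun (F := E →L[ℝ] ℝ) (h.mfderiv_eq (I := 𝓘(ℝ, E)) (I' := 𝓘(ℝ, ℝ))) v

variable [IsManifold 𝓘(ℝ, E) ∞ M] {X Y Z : ∀ p : M, TangentSpace 𝓘(ℝ, E) p} {p : M}

/-- Jacobi identity in cyclic form. -/
theorem jacobi_mlieBracket [CompleteSpace E] (hX : SmoothFieldNear X p)
    (hY : SmoothFieldNear Y p) (hZ : SmoothFieldNear Z p) :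
    mlieBracket 𝓘(ℝ, E) X (mlieBracket 𝓘(ℝ, E) Y Z) p
      + mlieBracket 𝓘(ℝ, E) Y (mlieBracket 𝓘(ℝ, E) Z X) p
      + mlieBracket 𝓘(ℝ, E) Z (mlieBracket 𝓘(ℝ, E) X Y) p = 0 := by
  have : IsManifold 𝓘(ℝ, E) (minSmoothness ℝ 3) M :=
    IsManifold.of_le (n := ∞) (by simpa using ENat.LEInfty.out)
  have hc : ∀ {V : ∀ p : M, TangentSpace 𝓘(ℝ, E) p}, SmoothFieldNear V p →
      CMDiffAt (minSmoothness ℝ 2) (T% V) p := fun h ↦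
    h.contMDiffAt.of_le (by simpa using ENat.LEInfty.out)
  have key := leibniz_identity_mlieBracket_apply (hc hX) (hc hY) (hc hZ)
  have h1 : mlieBracket 𝓘(ℝ, E) Y (mlieBracket 𝓘(ℝ, E) Z X) p
      = -mlieBracket 𝓘(ℝ, E) Y (mlieBracket 𝓘(ℝ, E) X Z) p := by
    have h0 : mlieBracket 𝓘(ℝ, E) Z X = (-1 : ℝ) • mlieBracket 𝓘(ℝ, E) X Z := by
      rw [mlieBracket_swap (V := Z)]; module
    rw [h0, mlieBracket_const_smul_right (smoothFieldNear_mlieBracket hX hZ).mdiffAt]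
    module
  rw [h1, key, mlieBracket_swap_apply (V := Z)]
  module

end

/-! ### Curvature: symmetries, tensoriality and Bianchi identities -/

namespace PseudoRiemannianMetric

variable {E : Type v} [NormedAddCommGroup E] [NormedSpace ℝ E] [FiniteDimensional ℝ E]
  {M : Type u} [TopologicalSpace M] [ChartedSpace E M] [IsManifold 𝓘(ℝ, E) ∞ M]
  {W X Y Z : ∀ p : M, TangentSpace 𝓘(ℝ, E) p} {p : M}

/-- The vector field `∇_X Y`. -/
noncomputable def nabla (g : PseudoRiemannianMetric E M)
    (X Y : ∀ p : M, TangentSpace 𝓘(ℝ, E) p) (p : M) : TangentSpace 𝓘(ℝ, E) p :=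
  g.leviCivita Y p (X p)

theorem smoothFieldNear_nabla (g : PseudoRiemannianMetric E M) (hX : SmoothFieldNear X p)
    (hY : SmoothFieldNear Y p) : SmoothFieldNear (g.nabla X Y) p :=
  g.smoothFieldNear_leviCivita hX hY

theorem nabla_add_right (g : PseudoRiemannianMetric E M) (hY : SmoothFieldNear Y p)
    (hZ : SmoothFieldNear Z p) : g.nabla X (Y + Z) p = g.nabla X Y p + g.nabla X Z p := by
  simp only [nabla]
  rw [g.leviCivita.isCovariantDerivativeOnUniv.add hY.mdiffAt hZ.mdiffAt]
  rfl

theorem nabla_smul_right (g : PseudoRiemannianMetric E M) {f : M → ℝ} (hf : SmoothFunNear E f p)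
    (hY : SmoothFieldNear Y p) : g.nabla X (f • Y) p
      = f p • g.nabla X Y p + mvfderiv 𝓘(ℝ, E) f p (X p) • Y p := by
  simp only [nabla]
  rw [g.leviCivita.isCovariantDerivativeOnUniv.leibniz hY.mdiffAt hf.mdiffAt]
  rfl

theorem nabla_const_smul_right (g : PseudoRiemannianMetric E M) (c : ℝ)
    (hY : SmoothFieldNear Y p) : g.nabla X (c • Y) p = c • g.nabla X Y p := by
  have := g.nabla_smul_right (X := X) (SmoothFunNear.const c) hY
  rw [mvfderiv_const] at this
  simpa using! this

theorem nabla_sub_right (g : PseudoRiemannianMetric E M) (hY : SmoothFieldNear Y p)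
    (hZ : SmoothFieldNear Z p) : g.nabla X (Y - Z) p = g.nabla X Y p - g.nabla X Z p := by
  have h : Y - Z = Y + (-1 : ℝ) • Z := by module
  rw [h, g.nabla_add_right hY (hZ.const_smul _), g.nabla_const_smul_right _ hZ]
  module

theorem nabla_congr (g : PseudoRiemannianMetric E M) (hY : SmoothFieldNear Y p)
    (h : ∀ᶠ q in 𝓝 p, Z q = Y q) : g.nabla X Z p = g.nabla X Y p := by
  simp only [nabla]
  rw [(g.leviCivita.isCovariantDerivativeOnUniv).congr_of_eventuallyEq
    (hY.congr h).mdiffAt hY.mdiffAt univ_mem h]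

theorem nabla_sub_nabla (g : PseudoRiemannianMetric E M) (hX : SmoothFieldNear X p)
    (hY : SmoothFieldNear Y p) :
    g.nabla X Y p - g.nabla Y X p = mlieBracket 𝓘(ℝ, E) X Y p :=
  g.leviCivita_torsion hX.mdiffAt hY.mdiffAt

theorem mvfderiv_inner (g : PseudoRiemannianMetric E M) (hX : SmoothFieldNear X p)
    (hY : SmoothFieldNear Y p) (hZ : SmoothFieldNear Z p) :
    mvfderiv 𝓘(ℝ, E) (fun q ↦ g.inner q (Y q) (Z q)) p (X p)
      = g.inner p (g.nabla X Y p) (Z p) + g.inner p (Y p) (g.nabla X Z p) :=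
  g.leviCivita_metric hX.mdiffAt hY.mdiffAt hZ.mdiffAt

theorem curvatureField_eq (g : PseudoRiemannianMetric E M)
    (X Y Z : ∀ p : M, TangentSpace 𝓘(ℝ, E) p) : g.curvatureField X Y Z
      = g.nabla X (g.nabla Y Z) - g.nabla Y (g.nabla X Z)
        - g.nabla (mlieBracket 𝓘(ℝ, E) X Y) Z := rfl

theorem smoothFieldNear_curvatureField (g : PseudoRiemannianMetric E M)
    (hX : SmoothFieldNear X p) (hY : SmoothFieldNear Y p) (hZ : SmoothFieldNear Z p) :
    SmoothFieldNear (g.curvatureField X Y Z) p := by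
  have : CompleteSpace E := FiniteDimensional.complete ℝ E
  rw [curvatureField_eq]
  exact ((g.smoothFieldNear_nabla hX (g.smoothFieldNear_nabla hY hZ)).sub
    (g.smoothFieldNear_nabla hY (g.smoothFieldNear_nabla hX hZ))).sub
    (g.smoothFieldNear_nabla (smoothFieldNear_mlieBracket hX hY) hZ)

theorem curvatureField_swap (g : PseudoRiemannianMetric E M)
    (X Y Z : ∀ p : M, TangentSpace 𝓘(ℝ, E) p) :
    g.curvatureField X Y Z p = -g.curvatureField Y X Z p := by
  simp only [curvatureField_eq, Pi.sub_apply, nabla,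
    mlieBracket_swap_apply (V := X) (W := Y), map_neg]
  module

/-- The first Bianchi identity. -/
theorem curvatureField_bianchi (g : PseudoRiemannianMetric E M)
    (hX : SmoothFieldNear X p) (hY : SmoothFieldNear Y p) (hZ : SmoothFieldNear Z p) :
    g.curvatureField X Y Z p + g.curvatureField Y Z X p + g.curvatureField Z X Y p = 0 := by
  have : CompleteSpace E := FiniteDimensional.complete ℝ E
  -- Two uses of vanishing torsion turn second derivatives into an iterated bracket; the cyclic sum
  -- is the Jacobi identity.
  have key : ∀ {X Y Z : ∀ p : M, TangentSpace 𝓘(ℝ, E) p}, SmoothFieldNear X p →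
      SmoothFieldNear Y p → SmoothFieldNear Z p →
      g.nabla X (g.nabla Y Z) p - g.nabla X (g.nabla Z Y) p
        - g.nabla (mlieBracket 𝓘(ℝ, E) Y Z) X p
        = mlieBracket 𝓘(ℝ, E) X (mlieBracket 𝓘(ℝ, E) Y Z) p := by
    intro X Y Z hX hY hZ
    rw [← g.nabla_sub_right (g.smoothFieldNear_nabla hY hZ) (g.smoothFieldNear_nabla hZ hY),
      ← g.nabla_sub_nabla hX (smoothFieldNear_mlieBracket hY hZ)]
    congr 1
    refine g.nabla_congr (smoothFieldNear_mlieBracket hY hZ) ?_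
    filter_upwards [hY.eventually, hZ.eventually] with q h1 h2 using g.nabla_sub_nabla h1 h2
  have h := jacobi_mlieBracket hX hY hZ
  rw [← key hX hY hZ, ← key hY hZ hX, ← key hZ hX hY] at h
  rw [← h]
  simp only [curvatureField_eq, Pi.sub_apply]
  module

/-- Differentiate g(Z,W) twice using metric compatibility. The commutator of the two derivatives is
the derivative along [X,Y], and the products of first derivatives cancel. -/
theorem inner_curvatureField_antisymm (g : PseudoRiemannianMetric E M)
    (hX : SmoothFieldNear X p) (hY : SmoothFieldNear Y p) (hZ : SmoothFieldNear Z p)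
    (hW : SmoothFieldNear W p) :
    g.inner p (g.curvatureField X Y Z p) (W p) = -g.inner p (g.curvatureField X Y W p) (Z p) := by
  have : CompleteSpace E := FiniteDimensional.complete ℝ E
  have hd : ∀ {U V : ∀ p : M, TangentSpace 𝓘(ℝ, E) p}, SmoothFieldNear U p →
      SmoothFieldNear V p →
      mvfderiv 𝓘(ℝ, E) (fun q ↦ mvfderiv 𝓘(ℝ, E) (fun q ↦ g.inner q (Z q) (W q)) q (V q)) p (U p)
        = g.inner p (g.nabla U (g.nabla V Z) p) (W p) + g.inner p (g.nabla V Z p) (g.nabla U W p)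
          + (g.inner p (g.nabla U Z p) (g.nabla V W p)
            + g.inner p (Z p) (g.nabla U (g.nabla V W) p)) := by
    intro U V hU hV
    have e : (fun q ↦ mvfderiv 𝓘(ℝ, E) (fun q ↦ g.inner q (Z q) (W q)) q (V q)) =ᶠ[𝓝 p]
        fun q ↦ g.inner q (g.nabla V Z q) (W q) + g.inner q (Z q) (g.nabla V W q) := by
      filter_upwards [hV.eventually, hZ.eventually, hW.eventually] with q h1 h2 h3
      exact g.mvfderiv_inner h1 h2 h3
    have hVZ := g.smoothFieldNear_nabla hV hZ
    have hVW := g.smoothFieldNear_nabla hV hW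
    rw [← g.mvfderiv_inner hU hVZ hW, ← g.mvfderiv_inner hU hZ hVW]
    rw [e.mvfderiv_apply_eq, mvfderiv_fun_add (g.smoothFunNear_inner hVZ hW).mdiffAt
      (g.smoothFunNear_inner hZ hVW).mdiffAt]
    rfl
  have hb := mvfderiv_mlieBracket hX hY (g.smoothFunNear_inner hZ hW)
  rw [hd hX hY, hd hY hX, g.mvfderiv_inner (smoothFieldNear_mlieBracket hX hY) hZ hW] at hb
  rw [g.symm p _ (Z p)]
  simp only [curvatureField_eq, Pi.sub_apply, map_sub, sub_apply]
  linarith [g.symm p (g.nabla X Z p) (g.nabla Y W p)]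

theorem inner_curvatureField_pair_symm (g : PseudoRiemannianMetric E M)
    (hX : SmoothFieldNear X p) (hY : SmoothFieldNear Y p) (hZ : SmoothFieldNear Z p)
    (hW : SmoothFieldNear W p) :
    g.inner p (g.curvatureField X Y Z p) (W p) = g.inner p (g.curvatureField Z W X p) (Y p) := by
  refine pair_symm_of_bianchi
    (T := {X : ∀ p : M, TangentSpace 𝓘(ℝ, E) p // SmoothFieldNear X p})
    (fun X Y Z W ↦ g.inner p (g.curvatureField X.1 Y.1 Z.1 p) (W.1 p)) ?_ ?_ ?_
    ⟨X, hX⟩ ⟨Y, hY⟩ ⟨Z, hZ⟩ ⟨W, hW⟩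
  · intro x y z w
    rw [g.curvatureField_swap x.1, map_neg, neg_apply]
  · exact fun x y z w ↦ g.inner_curvatureField_antisymm x.2 y.2 z.2 w.2
  · intro x y z w
    rw [← add_apply, ← add_apply, ← map_add, ← map_add, g.curvatureField_bianchi x.2 y.2 z.2]
    simp

/-- The fourth slot takes a vector rather than a field, so it is pointwise from the start.
Antisymmetry and pair symmetry carry every other slot into that position, which proves tensoriality
without a Leibniz computation. -/
theorem inner_curvatureField_congr (g : PseudoRiemannianMetric E M)
    {X' Y' Z' : ∀ p : M, TangentSpace 𝓘(ℝ, E) p}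
    (hX : SmoothFieldNear X p) (hY : SmoothFieldNear Y p) (hZ : SmoothFieldNear Z p)
    (hX' : SmoothFieldNear X' p) (hY' : SmoothFieldNear Y' p) (hZ' : SmoothFieldNear Z' p)
    (eX : X p = X' p) (eY : Y p = Y' p) (eZ : Z p = Z' p) (u : TangentSpace 𝓘(ℝ, E) p) :
    g.inner p (g.curvatureField X Y Z p) u = g.inner p (g.curvatureField X' Y' Z' p) u := by
  have hU := smoothFieldNear_extend u
  rw [← FiberBundle.extend_apply_self (F := E) u]
  set U := FiberBundle.extend E u
  rw [g.inner_curvatureField_antisymm hX hY hZ hU, eZ,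
    ← g.inner_curvatureField_antisymm hX hY hZ' hU, g.inner_curvatureField_pair_symm hX hY hZ' hU,
    eY, g.inner_curvatureField_antisymm hZ' hU hX hY', eX,
    ← g.inner_curvatureField_antisymm hZ' hU hX' hY',
    g.inner_curvatureField_pair_symm hZ' hU hX' hY']

theorem curvature_apply (g : PseudoRiemannianMetric E M)
    (hX : SmoothFieldNear X p) (hY : SmoothFieldNear Y p) (hZ : SmoothFieldNear Z p)
    (u : TangentSpace 𝓘(ℝ, E) p) :
    g.curvature p (X p) (Y p) (Z p) u = g.inner p (g.curvatureField X Y Z p) u :=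
  g.inner_curvatureField_congr (smoothFieldNear_extend _) (smoothFieldNear_extend _)
    (smoothFieldNear_extend _) hX hY hZ (by simp) (by simp) (by simp) u

/-- The second Bianchi identity. -/
theorem second_bianchi (g : PseudoRiemannianMetric E M)
    (hX : SmoothFieldNear X p) (hY : SmoothFieldNear Y p) (hZ : SmoothFieldNear Z p)
    (hW : SmoothFieldNear W p) :
    (g.nabla X (g.curvatureField Y Z W) p - g.curvatureField Y Z (g.nabla X W) p
        + g.curvatureField X (mlieBracket 𝓘(ℝ, E) Y Z) W p)
      + (g.nabla Y (g.curvatureField Z X W) p - g.curvatureField Z X (g.nabla Y W) p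
        + g.curvatureField Y (mlieBracket 𝓘(ℝ, E) Z X) W p)
      + (g.nabla Z (g.curvatureField X Y W) p - g.curvatureField X Y (g.nabla Z W) p
        + g.curvatureField Z (mlieBracket 𝓘(ℝ, E) X Y) W p) = 0 := by
  have : CompleteSpace E := FiniteDimensional.complete ℝ E
  -- Each summand becomes third derivatives of W minus the derivative along an iterated bracket.
  -- Over the cyclic sum the former cancel and the latter vanish by Jacobi.
  have key : ∀ {X Y Z : ∀ p : M, TangentSpace 𝓘(ℝ, E) p}, SmoothFieldNear X p →
      SmoothFieldNear Y p → SmoothFieldNear Z p →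
      g.nabla X (g.curvatureField Y Z W) p - g.curvatureField Y Z (g.nabla X W) p
        + g.curvatureField X (mlieBracket 𝓘(ℝ, E) Y Z) W p
      = g.nabla X (g.nabla Y (g.nabla Z W)) p - g.nabla X (g.nabla Z (g.nabla Y W)) p
        - g.nabla Y (g.nabla Z (g.nabla X W)) p + g.nabla Z (g.nabla Y (g.nabla X W)) p
        - g.leviCivita W p (mlieBracket 𝓘(ℝ, E) X (mlieBracket 𝓘(ℝ, E) Y Z) p) := by
    intro X Y Z hX hY hZ
    have hYZ := smoothFieldNear_mlieBracket hY hZ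
    have h1 := g.smoothFieldNear_nabla hY (g.smoothFieldNear_nabla hZ hW)
    have h2 := g.smoothFieldNear_nabla hZ (g.smoothFieldNear_nabla hY hW)
    rw [curvatureField_eq g Y Z W, g.nabla_sub_right (h1.sub h2) (g.smoothFieldNear_nabla hYZ hW),
      g.nabla_sub_right h1 h2]
    simp only [curvatureField_eq, Pi.sub_apply]
    simp only [nabla]
    module
  rw [key hX hY hZ, key hY hZ hX, key hZ hX hY]
  have h := congrArg (g.leviCivita W p) (jacobi_mlieBracket hX hY hZ)
  simp only [map_add, map_zero] at h
  rw [← neg_eq_zero, ← h]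
  module

end PseudoRiemannianMetric

/-! ### Immersed surfaces and curvature-invariant planes -/

/-- A chart in the maximal atlas has invertible derivative. -/
theorem isInvertible_mfderiv_of_mem_maximalAtlas {E : Type*} [NormedAddCommGroup E]
    [NormedSpace ℝ E] {H : Type*} [TopologicalSpace H] {I : ModelWithCorners ℝ E H}
    {M : Type*} [TopologicalSpace M] [ChartedSpace H M] {e : OpenPartialHomeomorph M H}
    (he : e ∈ IsManifold.maximalAtlas I ∞ M) {x : M}
    (hx : x ∈ e.source) : (mfderiv I I e x).IsInvertible := by
  have hd : OpenPartialHomeomorph.MDifferentiable I I e :=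
    ⟨(contMDiffOn_of_mem_maximalAtlas he).mdifferentiableOn (by simp),
      (contMDiffOn_symm_of_mem_maximalAtlas he).mdifferentiableOn (by simp)⟩
  exact ⟨hd.mfderiv hx, rfl⟩

namespace PseudoRiemannianMetric

variable {E : Type v} [NormedAddCommGroup E] [NormedSpace ℝ E] [FiniteDimensional ℝ E]
  {M : Type u} [TopologicalSpace M] [ChartedSpace E M] [IsManifold 𝓘(ℝ, E) ∞ M]
  {N : Type u} [TopologicalSpace N] [ChartedSpace (EuclideanSpace ℝ (Fin 2)) N]
  {X Y Z : ∀ p : M, TangentSpace 𝓘(ℝ, E) p} {f : N → M} {q : N}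

/-- The vector field `X`, smooth near `f q`, is tangent to the surface `f` near `q`. -/
def IsTangentNear (f : N → M) (q : N) (X : ∀ p : M, TangentSpace 𝓘(ℝ, E) p) : Prop :=
  SmoothFieldNear X (f q) ∧ ∀ᶠ r in 𝓝 q, X (f r) ∈ tangentPlane (E := E) f r

/-- Every tangent vector of an immersed surface extends to a field tangent to the surface. -/
theorem exists_isTangentNear [IsManifold (𝓡 2) ∞ N]
    (hf : Manifold.IsImmersionAt (𝓡 2) 𝓘(ℝ, E) ∞ f q)
    {x : TangentSpace 𝓘(ℝ, E) (f q)} (hx : x ∈ tangentPlane (E := E) f q) :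
    ∃ X : ∀ p : M, TangentSpace 𝓘(ℝ, E) p, IsTangentNear f q X ∧ X (f q) = x := by
  have : CompleteSpace E := FiniteDimensional.complete ℝ E
  obtain ⟨w, rfl⟩ := hx
  set φ := hf.domChart
  set ψ := hf.codChart
  have hφ : φ ∈ IsManifold.maximalAtlas (𝓡 2) ∞ N := hf.domChart_mem_maximalAtlas
  have hψ : ψ ∈ IsManifold.maximalAtlas 𝓘(ℝ, E) ∞ M := hf.codChart_mem_maximalAtlas
  have hφq : q ∈ φ.source := hf.mem_domChart_source
  -- In charts adapted to the immersion, `f` is the linear inclusion `ι`. A constant field in the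
  -- image of `ι`, pulled back by the codomain chart, is therefore tangent along the surface.
  let ι : EuclideanSpace ℝ (Fin 2) →L[ℝ] E :=
    hf.equiv.toContinuousLinearMap ∘L (ContinuousLinearMap.inl ℝ _ _)
  have hι : ∀ r ∈ φ.source, ψ (f r) = ι (φ r) := by
    intro r hr
    have h1 : (φ.extend (𝓡 2)) r ∈ (φ.extend (𝓡 2)).target :=
      (φ.extend (𝓡 2)).map_source (by simpa using hr)
    have h2 := hf.writtenInCharts h1
    simp only [Function.comp_apply] at h2
    rw [(φ.extend (𝓡 2)).left_inv (by simpa using hr)] at h2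
    simpa [ι] using! h2
  have hd : ∀ r ∈ φ.source, ∀ v : TangentSpace (𝓡 2) r,
      mfderiv 𝓘(ℝ, E) 𝓘(ℝ, E) ψ (f r) (mfderiv (𝓡 2) 𝓘(ℝ, E) f r v)
        = ι (mfderiv (𝓡 2) (𝓡 2) φ r v) := by
    intro r hr v
    have hfr : MDifferentiableAt (𝓡 2) 𝓘(ℝ, E) f r :=
      (hf.contMDiffOn.contMDiffAt (φ.open_source.mem_nhds hr)).mdifferentiableAt (by simp)
    have hψr : MDifferentiableAt 𝓘(ℝ, E) 𝓘(ℝ, E) ψ (f r) :=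
      ((contMDiffOn_of_mem_maximalAtlas hψ).contMDiffAt (ψ.open_source.mem_nhds
        (hf.source_subset_preimage_source hr))).mdifferentiableAt (by simp)
    have hφr : MDifferentiableAt (𝓡 2) (𝓡 2) φ r :=
      ((contMDiffOn_of_mem_maximalAtlas hφ).contMDiffAt
        (φ.open_source.mem_nhds hr)).mdifferentiableAt (by simp)
    have h1 := mfderiv_comp r hψr hfr
    have h2 := mfderiv_comp (I'' := 𝓘(ℝ, E)) r (ι.mdifferentiableAt (x := φ r)) hφr
    have h3 : (ψ ∘ f) =ᶠ[𝓝 r] (ι ∘ φ) := by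
      filter_upwards [φ.open_source.mem_nhds hr] with s hs using hι s hs
    rw [h3.mfderiv_eq, h2, ι.mfderiv_eq] at h1
    exact (DFunLike.congr_fun (F := EuclideanSpace ℝ (Fin 2) →L[ℝ] E) h1 v).symm
  let X : ∀ p : M, TangentSpace 𝓘(ℝ, E) p :=
    mpullback 𝓘(ℝ, E) 𝓘(ℝ, E) ψ (fun _ ↦ ι (mfderiv (𝓡 2) (𝓡 2) φ q w))
  have hX : ∀ r ∈ φ.source, ∀ v : TangentSpace (𝓡 2) r,
      (mfderiv (𝓡 2) (𝓡 2) φ r v : EuclideanSpace ℝ (Fin 2)) = mfderiv (𝓡 2) (𝓡 2) φ q w →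
      X (f r) = mfderiv (𝓡 2) 𝓘(ℝ, E) f r v := by
    intro r hr v hv
    have h1 : X (f r) = (mfderiv 𝓘(ℝ, E) 𝓘(ℝ, E) ψ (f r)).inverse
        (ι (mfderiv (𝓡 2) (𝓡 2) φ q w)) := rfl
    obtain ⟨A, hA⟩ := isInvertible_mfderiv_of_mem_maximalAtlas hψ
      (hf.source_subset_preimage_source hr)
    rw [h1, ← hv, ← hd r hr v, ← hA, ContinuousLinearMap.inverse_equiv]
    exact A.symm_apply_apply _
  refine ⟨X, ⟨?_, ?_⟩, hX q hφq w rfl⟩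
  · filter_upwards [ψ.open_source.mem_nhds hf.mem_codChart_source] with p hp
    refine ContMDiffAt.mpullback_vectorField_preimage (m := ∞) (n := ∞) ?_
      ((contMDiffOn_of_mem_maximalAtlas hψ).contMDiffAt (ψ.open_source.mem_nhds hp))
      (isInvertible_mfderiv_of_mem_maximalAtlas hψ hp) (by simp)
    exact contMDiffAt_vectorSpace_iff_contDiffAt.2 contDiffAt_const
  · filter_upwards [φ.open_source.mem_nhds hφq] with r hr
    obtain ⟨A, hA⟩ := isInvertible_mfderiv_of_mem_maximalAtlas hφ hr
    obtain ⟨v, hv⟩ := A.surjective (mfderiv (𝓡 2) (𝓡 2) φ q w)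
    refine ⟨v, (hX r hr v ?_).symm⟩
    rw [← hA]
    exact hv

/-- Tangency in a neighbourhood, not only at the point, is what allows covariant derivatives to be
iterated inside the surface. -/
theorem IsTangentNear.nabla {g : PseudoRiemannianMetric E M} (ht : g.IsTotallyGeodesic f)
    (hf : ContinuousAt f q) (hX : IsTangentNear f q X) (hY : IsTangentNear f q Y) :
    IsTangentNear f q (g.nabla X Y) := by
  refine ⟨g.smoothFieldNear_nabla hX.1 hY.1, ?_⟩
  filter_upwards [hf.eventually hY.1.eventually, hX.2, hY.2.eventually_nhds] with r h1 h2 h3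
  exact ht r Y h1.mdiffAt h3 _ h2

/-- The tangent planes of a totally geodesic surface are invariant under their curvature
operators. -/
theorem IsTotallyGeodesic.curvature_eq_zero [IsManifold (𝓡 2) ∞ N]
    {g : PseudoRiemannianMetric E M} (ht : g.IsTotallyGeodesic f)
    (hf : Manifold.IsImmersionAt (𝓡 2) 𝓘(ℝ, E) ∞ f q) {x y z u : TangentSpace 𝓘(ℝ, E) (f q)}
    (hx : x ∈ tangentPlane (E := E) f q) (hy : y ∈ tangentPlane (E := E) f q)
    (hz : z ∈ tangentPlane (E := E) f q)
    (hu : ∀ w ∈ tangentPlane (E := E) f q, g.inner (f q) w u = 0) :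
    g.curvature (f q) x y z u = 0 := by
  obtain ⟨X, hX, rfl⟩ := exists_isTangentNear hf hx
  obtain ⟨Y, hY, rfl⟩ := exists_isTangentNear hf hy
  obtain ⟨Z, hZ, rfl⟩ := exists_isTangentNear hf hz
  have hc := hf.continuousAt
  rw [g.curvature_apply hX.1 hY.1 hZ.1]
  refine hu _ ?_
  -- The bracket is tangent because it equals ∇_X Y - ∇_Y X.
  have hbr : mlieBracket 𝓘(ℝ, E) X Y (f q) ∈ tangentPlane (E := E) f q := by
    rw [← g.nabla_sub_nabla hX.1 hY.1]
    exact Submodule.sub_mem _ (hX.nabla ht hc hY).2.self_of_nhds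
      (hY.nabla ht hc hX).2.self_of_nhds
  rw [g.curvatureField_eq]
  refine Submodule.sub_mem _ (Submodule.sub_mem _
    (hX.nabla ht hc (hY.nabla ht hc hZ)).2.self_of_nhds
    (hY.nabla ht hc (hX.nabla ht hc hZ)).2.self_of_nhds) ?_
  exact ht q Z hZ.1.mdiffAt hZ.2 _ hbr

end PseudoRiemannianMetric

/-! ### Compatibility of curvature with the complex structure -/

namespace AlmostHermitianStructure

variable {E : Type v} [NormedAddCommGroup E] [NormedSpace ℝ E]
  {M : Type u} [TopologicalSpace M] [ChartedSpace E M] [IsManifold 𝓘(ℝ, E) ∞ M]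
  {X Y Z : ∀ p : M, TangentSpace 𝓘(ℝ, E) p} {p : M}

/-- The vector field `JX`. -/
noncomputable def JField (h : AlmostHermitianStructure E M)
    (X : ∀ p : M, TangentSpace 𝓘(ℝ, E) p) (p : M) : TangentSpace 𝓘(ℝ, E) p :=
  h.J p (X p)

theorem smoothFieldNear_JField (h : AlmostHermitianStructure E M) (hX : SmoothFieldNear X p) :
    SmoothFieldNear (h.JField X) p := by
  filter_upwards [hX] with q hq
  exact ContMDiffAt.clm_bundle_apply (h.contMDiff_J q) hq

theorem inner_J_left (h : AlmostHermitianStructure E M) (p : M) (x y : TangentSpace 𝓘(ℝ, E) p) :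
    h.inner p (h.J p x) y = -h.inner p x (h.J p y) := by
  rw [← h.inner_J_J p x (h.J p y), h.J_J, map_neg, neg_neg]

variable [FiniteDimensional ℝ E]

theorem IsKaehler.nabla_JField {h : AlmostHermitianStructure E M} (hK : h.IsKaehler)
    (hY : SmoothFieldNear Y p) : h.nabla X (h.JField Y) p = h.J p (h.nabla X Y p) :=
  hK p Y hY.mdiffAt (X p)

theorem IsKaehler.curvatureField_JField {h : AlmostHermitianStructure E M} (hK : h.IsKaehler)
    (hX : SmoothFieldNear X p) (hY : SmoothFieldNear Y p) (hZ : SmoothFieldNear Z p) :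
    h.curvatureField X Y (h.JField Z) p = h.J p (h.curvatureField X Y Z p) := by
  have key : ∀ {U V : ∀ p : M, TangentSpace 𝓘(ℝ, E) p}, SmoothFieldNear V p →
      h.nabla U (h.nabla V (h.JField Z)) p = h.J p (h.nabla U (h.nabla V Z) p) := by
    intro U V hV
    rw [← hK.nabla_JField (h.smoothFieldNear_nabla hV hZ)]
    refine h.nabla_congr (h.smoothFieldNear_JField (h.smoothFieldNear_nabla hV hZ)) ?_
    filter_upwards [hZ.eventually] with q hq using hK.nabla_JField hq
  simp only [h.curvatureField_eq, Pi.sub_apply, map_sub]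
  rw [key hX, key hY, hK.nabla_JField hZ]

end AlmostHermitianStructure

/-! ### Algebra of Kähler curvature tensors -/

section KaehlerAlgebra

variable {V : Type*} [AddCommGroup V] [Module ℝ V]

/-- `R` is an algebraic curvature tensor invariant under the complex structure `J`. -/
structure IsKaehlerCurvature (J : V →ₗ[ℝ] V) (R : V → V → V → V → ℝ) : Prop where
  add₄ (x y z u v : V) : R x y z (u + v) = R x y z u + R x y z v
  smul₄ (t : ℝ) (x y z u : V) : R x y z (t • u) = t * R x y z u
  antisymm_left (x y z u : V) : R x y z u = -R y x z u
  antisymm_right (x y z u : V) : R x y z u = -R x y u z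
  bianchi (x y z u : V) : R x y z u + R y z x u + R z x y u = 0
  J_right (x y z u : V) : R x y (J z) (J u) = R x y z u

namespace IsKaehlerCurvature

variable {J : V →ₗ[ℝ] V} {R R' : V → V → V → V → ℝ}

theorem pair_symm (hR : IsKaehlerCurvature J R) (x y z u : V) : R x y z u = R z u x y :=
  pair_symm_of_bianchi R hR.antisymm_left hR.antisymm_right hR.bianchi x y z u

theorem add₃ (hR : IsKaehlerCurvature J R) (x y z u v : V) :
    R x y (u + v) z = R x y u z + R x y v z := by
  rw [hR.antisymm_right, hR.add₄, hR.antisymm_right x y u, hR.antisymm_right x y v]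
  ring

theorem smul₃ (hR : IsKaehlerCurvature J R) (t : ℝ) (x y z u : V) :
    R x y (t • u) z = t * R x y u z := by
  rw [hR.antisymm_right, hR.smul₄, hR.antisymm_right x y u]
  ring

theorem add₂ (hR : IsKaehlerCurvature J R) (x z w u v : V) :
    R x (u + v) z w = R x u z w + R x v z w := by
  rw [hR.pair_symm, hR.add₄, hR.pair_symm x u, hR.pair_symm x v]

theorem smul₂ (hR : IsKaehlerCurvature J R) (t : ℝ) (x z w u : V) :
    R x (t • u) z w = t * R x u z w := by
  rw [hR.pair_symm, hR.smul₄, hR.pair_symm x u]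

theorem add₁ (hR : IsKaehlerCurvature J R) (y z w u v : V) :
    R (u + v) y z w = R u y z w + R v y z w := by
  rw [hR.pair_symm, hR.add₃, hR.pair_symm u, hR.pair_symm v]

theorem smul₁ (hR : IsKaehlerCurvature J R) (t : ℝ) (y z w u : V) :
    R (t • u) y z w = t * R u y z w := by
  rw [hR.pair_symm, hR.smul₃, hR.pair_symm u]

theorem J_left (hR : IsKaehlerCurvature J R) (x y z u : V) : R (J x) (J y) z u = R x y z u := by
  rw [hR.pair_symm, hR.J_right, hR.pair_symm]

theorem sub (hR : IsKaehlerCurvature J R) (hR' : IsKaehlerCurvature J R') :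
    IsKaehlerCurvature J (fun x y z u ↦ R x y z u - R' x y z u) where
  add₄ x y z u v := by rw [hR.add₄, hR'.add₄]; ring
  smul₄ t x y z u := by rw [hR.smul₄, hR'.smul₄]; ring
  antisymm_left x y z u := by rw [hR.antisymm_left, hR'.antisymm_left]; ring
  antisymm_right x y z u := by rw [hR.antisymm_right, hR'.antisymm_right]; ring
  bianchi x y z u := by linarith [hR.bianchi x y z u, hR'.bianchi x y z u]
  J_right x y z u := by rw [hR.J_right, hR'.J_right]

theorem const_mul (hR : IsKaehlerCurvature J R) (c : ℝ) :
    IsKaehlerCurvature J (fun x y z u ↦ c * R x y z u) where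
  add₄ x y z u v := by rw [hR.add₄]; ring
  smul₄ t x y z u := by rw [hR.smul₄]; ring
  antisymm_left x y z u := by rw [hR.antisymm_left]; ring
  antisymm_right x y z u := by rw [hR.antisymm_right]; ring
  bianchi x y z u := by linear_combination c * hR.bianchi x y z u
  J_right x y z u := by rw [hR.J_right]

theorem J_mid (hR : IsKaehlerCurvature J R) (hJ : ∀ x, J (J x) = -x) (x y z u : V) :
    R x y (J z) u = -R x y z (J u) := by
  rw [← hR.J_right x y (J z) u, hJ, ← neg_one_smul ℝ, hR.smul₃]
  ring

theorem J_out (hR : IsKaehlerCurvature J R) (hJ : ∀ x, J (J x) = -x) (x y z u : V) :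
    R (J x) y z u = -R x (J y) z u := by
  rw [hR.pair_symm, hR.J_mid hJ, hR.pair_symm]

/-- The holomorphic curvature along a line. -/
theorem holomorphic_line (hR : IsKaehlerCurvature J R) (hJ : ∀ x, J (J x) = -x) (v w : V)
    (t : ℝ) :
    R (v + t • w) (J (v + t • w)) (J (v + t • w)) (v + t • w)
      = R v (J v) (J v) v + 4 * t * R v (J v) (J v) w
        + t ^ 2 * (6 * R v (J w) (J w) v + 2 * R v w w v) + 4 * t ^ 3 * R w (J w) (J w) v
        + t ^ 4 * R w (J w) (J w) w := by
  simp only [map_add, map_smul, hR.add₁, hR.add₂, hR.add₃, hR.add₄, hR.smul₁, hR.smul₂, hR.smul₃,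
    hR.smul₄]
  have a1 : ∀ v w, R v (J v) (J w) v = R v (J v) (J v) w := fun v w ↦ by
    rw [hR.antisymm_right, hR.J_mid hJ v (J v) v w]
  have a2 : ∀ v w, R w (J v) (J v) v = R v (J v) (J v) w := fun v w ↦ by
    rw [hR.pair_symm, hR.antisymm_left, hR.antisymm_right, neg_neg]
  have a3 : ∀ v w, R v (J w) (J v) v = R v (J v) (J v) w := fun v w ↦ by
    rw [hR.pair_symm, hR.antisymm_left, hR.antisymm_right, neg_neg, a1]
  -- Bianchi is needed only for this mixed term; all other terms reduce by pair symmetry and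
  -- J-invariance.
  have b1 : R v (J v) (J w) w = R v (J w) (J w) v + R v w w v := by
    have h := hR.bianchi v (J v) (J w) w
    have h1 : R (J v) (J w) v w = -R v w w v := by
      rw [hR.J_left, hR.antisymm_right]
    have h2 : R (J w) v (J v) w = -R v (J w) (J w) v := by
      rw [hR.antisymm_left, hR.J_mid hJ, neg_neg, hR.antisymm_right]
    linarith
  have b2 : R w (J w) (J v) v = R v (J v) (J w) w := by
    rw [hR.pair_symm, hR.antisymm_left, hR.antisymm_right, neg_neg]
  have b3 : ∀ v w, R v (J w) (J v) w = R v (J w) (J w) v := fun v w ↦ by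
    rw [hR.J_mid hJ, hR.antisymm_right, neg_neg]
  have b5 : R w (J v) (J v) w = R v (J w) (J w) v := by
    linarith [hR.J_out hJ w v (J v) w, hR.J_mid hJ (J w) v v w, hR.antisymm_left (J w) v v (J w),
      hR.antisymm_right v (J w) v (J w)]
  rw [a1 v w, a2 v w, a3 v w, a1 w v, a2 w v, a3 w v, b2, b1, b3 v w, b3 w v, b5]
  ring

/-- A Kähler curvature tensor is determined by its holomorphic sectional curvatures. -/
theorem eq_zero (hR : IsKaehlerCurvature J R) (hJ : ∀ x, J (J x) = -x)
    (h : ∀ x, R x (J x) (J x) x = 0) (x y z u : V) : R x y z u = 0 := by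
  have h1 : ∀ v w, 3 * R v (J w) (J w) v + R v w w v = 0 := by
    intro v w
    have e1 := hR.holomorphic_line hJ v w 1
    have e2 := hR.holomorphic_line hJ v w (-1)
    simp only [h] at e1 e2
    linarith
  -- The relation `h1` for w and for Jw is a nonsingular 2 × 2 system in R(v,w,w,v) and
  -- R(v,Jw,Jw,v).
  have h2 : ∀ v w, R v w w v = 0 := by
    intro v w
    have e1 := h1 v w
    have e2 := h1 v (J w)
    rw [hJ] at e2
    simp only [← neg_one_smul ℝ w, hR.smul₂, hR.smul₃] at e2
    linarith
  have h3 : ∀ v w a, R v w w a = 0 := by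
    intro v w a
    have e := h2 (v + a) w
    simp only [hR.add₁, hR.add₄, h2] at e
    have e1 : R a w w v = R v w w a := by
      rw [hR.pair_symm, hR.antisymm_left, hR.antisymm_right, neg_neg]
    linarith
  have h4 : ∀ v w b a, R v w b a = -R v b w a := by
    intro v w b a
    have e := h3 v (w + b) a
    simp only [hR.add₂, hR.add₃, h3] at e
    linarith
  have e := hR.bianchi x y z u
  have e1 := h4 y z x u
  have e2 := hR.antisymm_left y x z u
  have e3 := h4 x y z u
  have e4 := hR.antisymm_left z x y u
  linarith

end IsKaehlerCurvature

/-- `B` is a symmetric bilinear form for which the complex structure `J` is an isometry. -/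
structure IsHermitianPair (B : V →ₗ[ℝ] V →ₗ[ℝ] ℝ) (J : V →ₗ[ℝ] V) : Prop where
  symm (x y : V) : B x y = B y x
  J_J (x : V) : J (J x) = -x
  isometry (x y : V) : B (J x) (J y) = B x y

/-- The curvature tensor of constant holomorphic sectional curvature `4`. -/
def modelCurvature (B : V →ₗ[ℝ] V →ₗ[ℝ] ℝ) (J : V →ₗ[ℝ] V) (x y z u : V) : ℝ :=
  B y z * B x u - B x z * B y u + B (J y) z * B (J x) u - B (J x) z * B (J y) u
    - 2 * B (J x) y * B (J z) u

namespace IsHermitianPair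

variable {B : V →ₗ[ℝ] V →ₗ[ℝ] ℝ} {J : V →ₗ[ℝ] V}

theorem J_left (h : IsHermitianPair B J) (x y : V) : B (J x) y = -B x (J y) := by
  rw [← h.isometry x (J y), h.J_J, map_neg, neg_neg]

theorem apply_J_self (h : IsHermitianPair B J) (x : V) : B x (J x) = 0 := by
  linarith [h.J_left x x, h.symm x (J x)]

theorem isKaehlerCurvature_model (h : IsHermitianPair B J) :
    IsKaehlerCurvature J (modelCurvature B J) where
  add₄ x y z u v := by simp only [modelCurvature, map_add]; ring
  smul₄ t x y z u := by simp only [modelCurvature, map_smul, smul_eq_mul]; ring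
  antisymm_left x y z u := by
    simp only [modelCurvature, h.J_left]
    rw [h.symm y (J x), h.J_left]
    ring
  antisymm_right x y z u := by
    simp only [modelCurvature, h.J_left]
    rw [h.symm u (J z), h.J_left]
    ring
  bianchi x y z u := by
    simp only [modelCurvature, h.J_left]
    rw [h.symm y (J x), h.symm z (J x), h.symm z (J y), h.J_left, h.J_left, h.J_left, h.symm y x,
      h.symm z x, h.symm z y]
    ring
  J_right x y z u := by
    simp only [modelCurvature, h.J_left, h.J_J, map_neg, LinearMap.neg_apply]
    ring

theorem model_holomorphic (h : IsHermitianPair B J) (x : V) :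
    modelCurvature B J x (J x) (J x) x = 4 * B x x ^ 2 := by
  simp only [modelCurvature, h.isometry, h.J_left, h.J_J, h.apply_J_self, map_neg,
    LinearMap.neg_apply]
  ring

end IsHermitianPair

/-! ### Hyperbolic frames and null vectors -/

/-- A hyperbolic frame: null vectors `x, y` spanning a totally isotropic complex plane, with
dual vectors `x', y'`. -/
structure IsHyperbolicFrame (B : V →ₗ[ℝ] V →ₗ[ℝ] ℝ) (J : V →ₗ[ℝ] V) (x y x' y' : V) : Prop where
  xx : B x x = 0
  yy : B y y = 0
  xx₂ : B x' x' = 0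
  yy₂ : B y' y' = 0
  dual_x : B x x' = 1
  dual_y : B y y' = 1
  xy : B x y = 0
  xy₂ : B x y' = 0
  yx₂ : B y x' = 0
  x₂y₂ : B x' y' = 0
  Jxx₂ : B x (J x') = 0
  Jyy₂ : B y (J y') = 0
  Jxy : B x (J y) = 0
  Jxy₂ : B x (J y') = 0
  Jyx₂ : B y (J x') = 0
  Jx₂y₂ : B x' (J y') = 0

/-- The curvature condition imposed by the axiom of strongly isotropic antiholomorphic planes. -/
def VanishesOnIsotropicPlanes (B : V →ₗ[ℝ] V →ₗ[ℝ] ℝ) (J : V →ₗ[ℝ] V)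
    (R : V → V → V → V → ℝ) : Prop :=
  -- The vector x' certifies that x lies outside the span of y and Jy, so that x, y span a plane
  -- which J does not preserve.
  ∀ x y x' w, B x x = 0 → B y y = 0 → B x y = 0 → B x (J y) = 0 → y ≠ 0 → B x' x ≠ 0 →
    B x' y = 0 → B x' (J y) = 0 → B x w = 0 → B y w = 0 → R x y y w = 0

namespace IsHyperbolicFrame

variable {B : V →ₗ[ℝ] V →ₗ[ℝ] ℝ} {J : V →ₗ[ℝ] V} {R : V → V → V → V → ℝ} {x y x' y' : V}

theorem y_ne_zero (hF : IsHyperbolicFrame B J x y x' y') : y ≠ 0 := by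
  rintro rfl
  simpa using hF.dual_y

/-- A one-parameter family of frames in which y moves towards x; the correction of x' preserves
duality. Identities valid in all frames can then be polarised in t. -/
theorem shear (h : IsHermitianPair B J) (hF : IsHyperbolicFrame B J x y x' y') (t : ℝ) :
    IsHyperbolicFrame B J x (y + t • x) (x' - t • y') y' := by
  constructor <;>
  simp only [map_add, map_sub, map_smul, LinearMap.add_apply, LinearMap.sub_apply,
    LinearMap.smul_apply, smul_eq_mul, hF.xx, hF.yy, hF.xx₂, hF.yy₂, hF.dual_x, hF.dual_y, hF.xy,
    hF.xy₂, hF.yx₂, hF.x₂y₂, hF.Jxx₂, hF.Jyy₂, hF.Jxy, hF.Jxy₂, hF.Jyx₂, hF.Jx₂y₂,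
    h.symm y x, h.symm y' x', h.apply_J_self] <;> ring

/-- Here y moves towards x'. The compensating -t y' keeps the two null vectors orthogonal, since the
products t and -t cancel. -/
theorem mix (h : IsHermitianPair B J) (hF : IsHyperbolicFrame B J x y x' y') (t : ℝ) :
    IsHyperbolicFrame B J (x - t • y') (y + t • x') x' y' := by
  constructor <;>
  simp only [map_add, map_sub, map_smul, LinearMap.add_apply, LinearMap.sub_apply,
    LinearMap.smul_apply, smul_eq_mul, hF.xx, hF.yy, hF.xx₂, hF.yy₂, hF.dual_x, hF.dual_y, hF.xy,
    hF.xy₂, hF.yx₂, hF.x₂y₂, hF.Jxx₂, hF.Jyy₂, hF.Jxy, hF.Jxy₂, hF.Jyx₂, hF.Jx₂y₂,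
    h.symm y' x, h.symm y' y, h.symm y' x', h.symm x' y, h.apply_J_self, h.symm y' (J y),
    h.symm y' (J x'), h.J_left] <;> ring

theorem rotate (h : IsHermitianPair B J) (hF : IsHyperbolicFrame B J x y x' y') :
    IsHyperbolicFrame B J (J x) y (J x') y' := by
  constructor <;>
  simp only [h.isometry, h.J_J, h.J_left, map_neg, hF.xx, hF.yy, hF.xx₂, hF.yy₂, hF.dual_x,
    hF.dual_y, hF.xy, hF.xy₂, hF.yx₂, hF.x₂y₂, hF.Jxx₂, hF.Jyy₂, hF.Jxy, hF.Jxy₂, hF.Jyx₂,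
    hF.Jx₂y₂, neg_zero]

theorem curvature_eq_zero (h : IsHermitianPair B J) (hA : VanishesOnIsotropicPlanes B J R)
    (hF : IsHyperbolicFrame B J x y x' y') {w : V} (h₁ : B x w = 0) (h₂ : B y w = 0) :
    R x y y w = 0 := by
  refine hA x y x' w hF.xx hF.yy hF.xy hF.Jxy hF.y_ne_zero ?_ ?_ ?_ h₁ h₂
  · rw [h.symm, hF.dual_x]; exact one_ne_zero
  · rw [h.symm, hF.yx₂]
  · rw [h.symm, h.J_left, hF.Jyx₂, neg_zero]

/-- Since Jy is null and orthogonal to x, y and Jx, adding it to x keeps the plane isotropic and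
antiholomorphic. This brings holomorphic curvature terms into the condition. -/
theorem curvature_shear_eq_zero (h : IsHermitianPair B J)
    (hA : VanishesOnIsotropicPlanes B J R) (hF : IsHyperbolicFrame B J x y x' y') {w : V}
    (h₁ : B (x + J y) w = 0) (h₂ : B y w = 0) : R (x + J y) y y w = 0 := by
  refine hA (x + J y) y x' w ?_ hF.yy ?_ ?_ hF.y_ne_zero ?_ ?_ ?_ h₁ h₂
  · simp [h.J_left, h.J_J, hF.xx, hF.yy, hF.Jxy, h.symm y (J x)]
  · simp [h.J_left, hF.xy, h.apply_J_self]
  · simp [h.isometry, hF.yy, hF.Jxy]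
  · simp only [map_add]
    rw [h.symm x' x, h.symm x' (J y), h.J_left, hF.dual_x, hF.Jyx₂]; norm_num
  · rw [h.symm, hF.yx₂]
  · rw [h.symm, h.J_left, hF.Jyx₂, neg_zero]

/-- Null holomorphic sectional curvatures vanish. -/
theorem holomorphic_eq_zero (h : IsHermitianPair B J) (hR : IsKaehlerCurvature J R)
    (hA : VanishesOnIsotropicPlanes B J R) (hF : IsHyperbolicFrame B J x y x' y') :
    R y (J y) (J y) y = 0 := by
  have e := curvature_shear_eq_zero h hA hF (w := x + J y)
    (by simp [h.J_left, h.J_J, hF.xx, hF.yy, hF.Jxy, h.symm y (J x)])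
    (by simp [h.symm y x, hF.xy, h.apply_J_self])
  have e1 := curvature_eq_zero h hA hF (w := x) hF.xx (by rw [h.symm, hF.xy])
  have e2 := curvature_eq_zero h hA hF (w := J y) hF.Jxy (h.apply_J_self y)
  have e3 : R (J y) y y x = R x y y (J y) := by
    rw [hR.pair_symm, hR.antisymm_left, hR.antisymm_right, neg_neg]
  have e4 : R (J y) y y (J y) = R y (J y) (J y) y := by
    rw [hR.antisymm_left, hR.antisymm_right, neg_neg]
  simp only [hR.add₁, hR.add₄] at e
  linarith

theorem holomorphic_x_eq_zero (h : IsHermitianPair B J) (hR : IsKaehlerCurvature J R)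
    (hA : VanishesOnIsotropicPlanes B J R) (hF : IsHyperbolicFrame B J x y x' y') :
    R y (J y) (J y) x = 0 := by
  -- The wanted term is, up to a factor 4, the coefficient of t in this quartic; its odd part is
  -- determined by the values at ±1 and ±2.
  have key : ∀ t : ℝ, R (y + t • x) (J (y + t • x)) (J (y + t • x)) (y + t • x) = 0 := fun t ↦
    holomorphic_eq_zero h hR hA (shear h hF t)
  have e1 := key 1
  have e2 := key (-1)
  have e3 := key 2
  have e4 := key (-2)
  simp only [hR.holomorphic_line h.J_J] at e1 e2 e3 e4
  linarith

/-- The vector x' - Jy' is orthogonal to x + Jy because the two dual pairings cancel. Of the four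
terms in the expansion, the two mixed ones vanish on the planes of x, y and of x', y. -/
theorem curvature_dual_eq (h : IsHermitianPair B J) (hR : IsKaehlerCurvature J R)
    (hA : VanishesOnIsotropicPlanes B J R) (hF : IsHyperbolicFrame B J x y x' y') :
    R x y y x' = R y (J y) (J y) y' := by
  have e := curvature_shear_eq_zero h hA hF (w := x' + (-1 : ℝ) • J y')
    (by simp [h.J_left, h.J_J, hF.dual_x, hF.dual_y, hF.Jxy₂, hF.Jyx₂])
    (by simp [hF.yx₂, hF.Jyy₂])
  have e1 := curvature_eq_zero h hA hF (w := J y') hF.Jxy₂ hF.Jyy₂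
  have e2 : R x' y y (J y) = 0 := by
    refine hA x' y x (J y) hF.xx₂ hF.yy ?_ ?_ hF.y_ne_zero ?_ hF.xy hF.Jxy ?_ (h.apply_J_self y)
    · rw [h.symm, hF.yx₂]
    · rw [h.symm, h.J_left, hF.Jyx₂, neg_zero]
    · rw [hF.dual_x]; exact one_ne_zero
    · rw [h.symm, h.J_left, hF.Jyx₂, neg_zero]
  have e3 : R (J y) y y x' = R x' y y (J y) := by
    rw [hR.pair_symm, hR.antisymm_left, hR.antisymm_right, neg_neg]
  have e4 : R (J y) y y (J y') = R y (J y) (J y) y' := by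
    rw [hR.antisymm_left, hR.J_mid h.J_J y (J y) y y']
  simp only [hR.add₁, hR.add₄, hR.smul₄] at e
  linarith

theorem holomorphic_dual_eq_zero (h : IsHermitianPair B J) (hR : IsKaehlerCurvature J R)
    (hA : VanishesOnIsotropicPlanes B J R) (hF : IsHyperbolicFrame B J x y x' y') :
    R y (J y) (J y) y' = 0 := by
  have key : ∀ t : ℝ, R (y + t • x') (J (y + t • x')) (J (y + t • x')) (x + (-t) • y') = 0 := by
    intro t
    have := holomorphic_x_eq_zero h hR hA (mix h hF t)
    rwa [sub_eq_add_neg, ← neg_smul] at this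
  have e1 := key 1
  have e2 := key (-1)
  have e3 := key 2
  have e4 := key (-2)
  simp only [map_add, map_smul, hR.add₁, hR.add₂, hR.add₃, hR.add₄, hR.smul₁, hR.smul₂, hR.smul₃,
    hR.smul₄] at e1 e2 e3 e4
  -- This is the coefficient of t, isolated from the odd part of the quartic.
  have d : -R y (J y) (J y) y' + R x' (J y) (J y) x + R y (J x') (J y) x + R y (J y) (J x') x
      = 0 := by linarith
  -- With H' = R(y,Jy,Jy,y'), the original and the rotated frame show that the last three terms of
  -- `d` equal H', H' and 2H'. So `d` reads 3H' = 0.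
  have k1 := curvature_dual_eq h hR hA hF
  have k2 := curvature_dual_eq h hR hA (rotate h hF)
  have c1 : R x' (J y) (J y) x = R (J x) y y (J x') := by
    rw [hR.pair_symm, hR.antisymm_left, hR.antisymm_right, neg_neg]
    linarith [hR.J_out h.J_J x y (J y) x', hR.J_mid h.J_J (J x) y y x']
  have c2 : R y (J x') (J y) x = R (J x) y y (J x') := by
    rw [hR.J_mid h.J_J, hR.pair_symm, hR.antisymm_left, neg_neg]
  have c3 : R y (J y) (J x') x = R x y y x' + R (J x) y y (J x') := by
    linarith [hR.bianchi y (J y) (J x') x, hR.J_left y x' y x, hR.pair_symm y x' y x,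
      hR.antisymm_left y x y x', hR.antisymm_left (J x') y (J y) x]
  linarith

end IsHyperbolicFrame

end KaehlerAlgebra

/-! ### From null frames to constant holomorphic curvature -/

section KaehlerAlgebra

variable {V : Type*} [AddCommGroup V] [Module ℝ V]
  {B : V →ₗ[ℝ] V →ₗ[ℝ] ℝ} {J : V →ₗ[ℝ] V} {R : V → V → V → V → ℝ}

/-- `a` is orthogonal to `b` and `J b`. -/
def IsComplexOrtho (B : V →ₗ[ℝ] V →ₗ[ℝ] ℝ) (J : V →ₗ[ℝ] V) (a b : V) : Prop :=
  B a b = 0 ∧ B a (J b) = 0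

namespace IsComplexOrtho

variable {a b : V}

theorem symm (h : IsHermitianPair B J) (hab : IsComplexOrtho B J a b) : IsComplexOrtho B J b a :=
  ⟨by rw [h.symm, hab.1], by rw [h.symm, h.J_left, hab.2, neg_zero]⟩

theorem smul_left (hab : IsComplexOrtho B J a b) (t : ℝ) : IsComplexOrtho B J (t • a) b := by
  simp [IsComplexOrtho, hab.1, hab.2]

theorem neg_right (hab : IsComplexOrtho B J a b) : IsComplexOrtho B J a (-b) := by
  simp [IsComplexOrtho, hab.1, hab.2]

theorem J_left (h : IsHermitianPair B J) (hab : IsComplexOrtho B J a b) :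
    IsComplexOrtho B J (J a) b :=
  ⟨by rw [h.J_left, hab.2, neg_zero], by rw [h.isometry, hab.1]⟩

end IsComplexOrtho

theorem isHyperbolicFrame_of_orthonormal (h : IsHermitianPair B J) {e f e₂ f₂ : V}
    (he : B e e = -1) (hf : B f f = 1) (he₂ : B e₂ e₂ = -1) (hf₂ : B f₂ f₂ = 1)
    (hef : IsComplexOrtho B J e f) (hee₂ : IsComplexOrtho B J e₂ e)
    (hfe₂ : IsComplexOrtho B J e₂ f) (hef₂ : IsComplexOrtho B J f₂ e)
    (hff₂ : IsComplexOrtho B J f₂ f) (he₂f₂ : IsComplexOrtho B J e₂ f₂) :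
    IsHyperbolicFrame B J (e₂ + f₂) (e + f) ((1 / 2 : ℝ) • (f₂ - e₂)) ((1 / 2 : ℝ) • (f - e)) := by
  constructor <;>
  simp only [map_add, map_sub, map_smul, LinearMap.add_apply, LinearMap.sub_apply,
    LinearMap.smul_apply, smul_eq_mul, he, hf, he₂, hf₂, hef.1, hef.2, hee₂.1, hee₂.2, hfe₂.1,
    hfe₂.2, hef₂.1, hef₂.2, hff₂.1, hff₂.2, he₂f₂.1, he₂f₂.2, (hef.symm h).1, (hef.symm h).2,
    (hee₂.symm h).1, (hee₂.symm h).2, (hfe₂.symm h).1, (hfe₂.symm h).2, (hef₂.symm h).1,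
    (hef₂.symm h).2, (hff₂.symm h).1, (hff₂.symm h).2, (he₂f₂.symm h).1, (he₂f₂.symm h).2,
    h.apply_J_self] <;> norm_num

/-- Holomorphic curvatures of orthogonal unit vectors of opposite sign agree. -/
theorem holomorphic_eq_of_orthonormal (h : IsHermitianPair B J) (hR : IsKaehlerCurvature J R)
    (hA : VanishesOnIsotropicPlanes B J R) {e f e₂ f₂ : V}
    (he : B e e = -1) (hf : B f f = 1) (he₂ : B e₂ e₂ = -1) (hf₂ : B f₂ f₂ = 1)
    (hef : IsComplexOrtho B J e f) (hee₂ : IsComplexOrtho B J e₂ e)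
    (hfe₂ : IsComplexOrtho B J e₂ f) (hef₂ : IsComplexOrtho B J f₂ e)
    (hff₂ : IsComplexOrtho B J f₂ f) (he₂f₂ : IsComplexOrtho B J e₂ f₂) :
    R e (J e) (J e) e = R f (J f) (J f) f := by
  -- Adding the identities for f and -f removes the terms odd in f. The mixed terms with two e's and
  -- two f's cancel by `s1`, `s2` and `s3`, leaving only the two holomorphic values.
  have k1 := (isHyperbolicFrame_of_orthonormal h he hf he₂ hf₂ hef hee₂ hfe₂ hef₂ hff₂
    he₂f₂).holomorphic_dual_eq_zero h hR hA
  have k2 := (isHyperbolicFrame_of_orthonormal h (f := -f) he (by simpa using hf) he₂ hf₂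
    hef.neg_right hee₂ hfe₂.neg_right hef₂ hff₂.neg_right he₂f₂).holomorphic_dual_eq_zero h hR hA
  simp only [← neg_one_smul ℝ f, sub_eq_add_neg, ← neg_one_smul ℝ e, map_add, map_smul, hR.add₁,
    hR.add₂, hR.add₃, hR.add₄, hR.smul₁, hR.smul₂, hR.smul₃, hR.smul₄] at k1 k2
  have s1 : R f (J f) (J e) e = R e (J e) (J f) f := by
    rw [hR.pair_symm, hR.antisymm_left, hR.antisymm_right, neg_neg]
  have s2 : R f (J e) (J f) e = R e (J f) (J e) f := by
    rw [hR.pair_symm, hR.antisymm_left, hR.antisymm_right, neg_neg]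
  have s3 : R f (J e) (J e) f = R e (J f) (J f) e := by
    linarith [hR.J_out h.J_J f e (J e) f, hR.J_mid h.J_J (J f) e e f,
      hR.antisymm_left (J f) e e (J f), hR.antisymm_right e (J f) e (J f)]
  linarith

/-- Any two vectors have a common orthogonal vector of square `ε`. -/
def HasManyUnitVectors (B : V →ₗ[ℝ] V →ₗ[ℝ] ℝ) (ε : ℝ) : Prop :=
  ∀ a b : V, ∃ n, B n n = ε ∧ B n a = 0 ∧ B n b = 0

theorem exists_smul_unit_of_neg {v : V} (hv : B v v < 0) : ∃ t : ℝ, B (t • v) (t • v) = -1 := by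
  refine ⟨(Real.sqrt (-B v v))⁻¹, ?_⟩
  have h1 : 0 < Real.sqrt (-B v v) := Real.sqrt_pos.2 (by linarith)
  have h2 : Real.sqrt (-B v v) ^ 2 = -B v v := Real.sq_sqrt (by linarith)
  simp only [map_smul, LinearMap.smul_apply, smul_eq_mul]
  field_simp
  linarith

theorem exists_smul_unit_of_pos {v : V} (hv : 0 < B v v) : ∃ t : ℝ, B (t • v) (t • v) = 1 := by
  refine ⟨(Real.sqrt (B v v))⁻¹, ?_⟩
  have h1 : 0 < Real.sqrt (B v v) := Real.sqrt_pos.2 hv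
  have h2 : Real.sqrt (B v v) ^ 2 = B v v := Real.sq_sqrt hv.le
  simp only [map_smul, LinearMap.smul_apply, smul_eq_mul]
  field_simp
  linarith

/-- Start with a negative vector orthogonal to a and Ja, and remove its component in the complex
line of f. That line is positive definite, so the remainder is even more negative. -/
theorem exists_negative_ortho (h : IsHermitianPair B J) (hN : HasManyUnitVectors B (-1)) {f a : V}
    (hf : B f f = 1) (hfa : IsComplexOrtho B J f a) :
    ∃ n, B n n = -1 ∧ IsComplexOrtho B J n a ∧ IsComplexOrtho B J n f := by
  obtain ⟨n, hn, hna, hnJa⟩ := hN a (J a)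
  set m := n - B n f • f - B n (J f) • J f with hm
  have hma : IsComplexOrtho B J m a := by
    constructor
    · simp [hm, hna, hfa.1, h.J_left, hfa.2]
    · simp [hm, hnJa, hfa.2, h.isometry, hfa.1]
  have hmf : IsComplexOrtho B J m f := by
    constructor
    · simp [hm, hf, h.J_left, h.apply_J_self]
    · simp [hm, h.isometry, hf, h.apply_J_self]
  have hmm : B m m < 0 := by
    have e1 : B m m = B m n := by
      conv_lhs => rw [hm]
      rw [← hm, map_sub, map_sub, map_smul, map_smul, hmf.1, hmf.2]
      simp
    rw [e1, h.symm]
    simp only [hm, map_sub, map_smul, smul_eq_mul, hn]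
    nlinarith [sq_nonneg (B n f), sq_nonneg (B n (J f))]
  obtain ⟨t, ht⟩ := exists_smul_unit_of_neg hmm
  exact ⟨t • m, ht, hma.smul_left t, hmf.smul_left t⟩

/-- Removing components in the negative definite lines of e and e₂ only increases the square; the
plus signs in the projection come from B e e = B e₂ e₂ = -1. -/
theorem exists_positive_ortho (h : IsHermitianPair B J) (hP : HasManyUnitVectors B 1)
    {e e₂ f : V} (he : B e e = -1) (he₂ : B e₂ e₂ = -1) (hee₂ : IsComplexOrtho B J e₂ e)
    (hef : IsComplexOrtho B J e f) (he₂f : IsComplexOrtho B J e₂ f) :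
    ∃ m, B m m = 1 ∧ IsComplexOrtho B J m e ∧ IsComplexOrtho B J m e₂ ∧
      IsComplexOrtho B J m f := by
  obtain ⟨p, hp, hpf, hpJf⟩ := hP f (J f)
  set m := p + B p e • e + B p (J e) • J e + B p e₂ • e₂ + B p (J e₂) • J e₂ with hm
  have hee₂' := hee₂.symm h
  have hmf : IsComplexOrtho B J m f := by
    constructor
    · simp [hm, hpf, hef.1, h.J_left, hef.2, he₂f.1, he₂f.2]
    · simp [hm, hpJf, hef.2, h.isometry, hef.1, he₂f.1, he₂f.2]
  have hme : IsComplexOrtho B J m e := by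
    constructor
    · simp [hm, he, h.J_left, h.apply_J_self, hee₂.1, hee₂.2]
    · simp [hm, h.isometry, he, h.apply_J_self, hee₂.1, hee₂.2]
  have hme₂ : IsComplexOrtho B J m e₂ := by
    constructor
    · simp [hm, he₂, h.J_left, h.apply_J_self, hee₂'.1, hee₂'.2]
    · simp [hm, h.isometry, he₂, h.apply_J_self, hee₂'.1, hee₂'.2]
  have hmm : 0 < B m m := by
    have e1 : B m m = B m p := by
      have e0 : m - p = B p e • e + B p (J e) • J e + B p e₂ • e₂ + B p (J e₂) • J e₂ := by
        rw [hm]; abel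
      have e2 : B m (m - p) = 0 := by
        rw [e0]; simp [hme.1, hme.2, hme₂.1, hme₂.2]
      rw [map_sub] at e2
      linarith
    rw [e1, h.symm]
    simp only [hm, map_add, map_smul, smul_eq_mul, hp]
    nlinarith [sq_nonneg (B p e), sq_nonneg (B p (J e)), sq_nonneg (B p e₂),
      sq_nonneg (B p (J e₂))]
  obtain ⟨t, ht⟩ := exists_smul_unit_of_pos hmm
  exact ⟨t • m, ht, hme.smul_left t, hme₂.smul_left t, hmf.smul_left t⟩

theorem holomorphic_eq_of_ortho (h : IsHermitianPair B J) (hR : IsKaehlerCurvature J R)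
    (hA : VanishesOnIsotropicPlanes B J R) (hN : HasManyUnitVectors B (-1))
    (hP : HasManyUnitVectors B 1) {e f : V} (he : B e e = -1) (hf : B f f = 1)
    (hef : IsComplexOrtho B J e f) : R e (J e) (J e) e = R f (J f) (J f) f := by
  obtain ⟨e₂, he₂, h1, h2⟩ := exists_negative_ortho h hN hf (hef.symm h)
  obtain ⟨f₂, hf₂, h3, h4, h5⟩ := exists_positive_ortho h hP he he₂ h1 hef h2
  exact holomorphic_eq_of_orthonormal h hR hA he hf he₂ hf₂ hef h1 h2 h3 h5 (h4.symm h)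

/-- A negative vector orthogonal to two complex lines, one of them positive. -/
theorem exists_negative_ortho_pair (h : IsHermitianPair B J) (hN : HasManyUnitVectors B (-1))
    {f : V} (hf : B f f = 1) (v : V) :
    ∃ n, B n n = -1 ∧ IsComplexOrtho B J n f ∧ IsComplexOrtho B J n v := by
  obtain ⟨e₁, he₁, -, h1⟩ := exists_negative_ortho h hN (a := 0) hf (by simp [IsComplexOrtho])
  by_cases hv : IsComplexOrtho B J e₁ v
  · exact ⟨e₁, he₁, h1, hv⟩
  obtain ⟨e₂, he₂, h2, h3⟩ := exists_negative_ortho h hN hf (h1.symm h)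
  have h2' := h2.symm h
  set α := B e₁ v
  set α' := B (J e₁) v with hα'
  have e1 : B e₁ (J v) = -α' := by rw [hα', h.J_left, neg_neg]
  have hpos : 0 < α ^ 2 + α' ^ 2 := by
    by_contra hcon
    have ha : α = 0 := by nlinarith [sq_nonneg α, sq_nonneg α']
    have ha' : α' = 0 := by nlinarith [sq_nonneg α, sq_nonneg α']
    exact hv ⟨ha, by rw [e1, ha', neg_zero]⟩
  set β := B e₂ v
  set β' := B (J e₂) v with hβ'
  have e2 : B e₂ (J v) = -β' := by rw [hβ', h.J_left, neg_neg]
  -- With z₁ = α + iα' and z₂ = β + iβ', this is -z₁ z̄₂ e₁ + |z₁|² e₂, i acting as J: the complex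
  -- combination that annihilates the Hermitian pairing with v. It is negative because the complex
  -- span of e₁, e₂ is negative definite and the coefficient of e₂ is nonzero.
  set n := (-(α * β + α' * β')) • e₁ + (α * β' - α' * β) • J e₁ + (α ^ 2 + α' ^ 2) • e₂ with hn
  have hnf : IsComplexOrtho B J n f := by
    constructor
    · simp [hn, h1.1, (h1.J_left h).1, h3.1]
    · simp [hn, h1.2, (h1.J_left h).2, h3.2]
  have hnv : IsComplexOrtho B J n v := by
    constructor
    · simp only [hn, map_add, map_smul, LinearMap.add_apply, LinearMap.smul_apply, smul_eq_mul]
      change -(α * β + α' * β') * α + (α * β' - α' * β) * α' + (α ^ 2 + α' ^ 2) * β = 0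
      ring
    · simp only [hn, map_add, map_smul, LinearMap.add_apply, LinearMap.smul_apply, smul_eq_mul,
        e1, e2, h.isometry]
      change -(α * β + α' * β') * -α' + (α * β' - α' * β) * α + (α ^ 2 + α' ^ 2) * -β' = 0
      ring
  have hnn : B n n < 0 := by
    have e3 : B n n = -((α * β + α' * β') ^ 2 + (α * β' - α' * β) ^ 2
        + (α ^ 2 + α' ^ 2) ^ 2) := by
      simp only [hn, map_add, map_smul, LinearMap.add_apply, LinearMap.smul_apply, smul_eq_mul,
        he₁, he₂, h.isometry, h.J_left, h.apply_J_self, h2.1, h2.2, h2'.1, h2'.2]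
      ring
    rw [e3]
    have := pow_pos hpos 2
    nlinarith [sq_nonneg (α * β + α' * β'), sq_nonneg (α * β' - α' * β)]
  obtain ⟨t, ht⟩ := exists_smul_unit_of_neg hnn
  exact ⟨t • n, ht, hnf.smul_left t, hnv.smul_left t⟩

theorem IsKaehlerCurvature.holomorphic_smul (hR : IsKaehlerCurvature J R) (t : ℝ) (v : V) :
    R (t • v) (J (t • v)) (J (t • v)) (t • v) = t ^ 4 * R v (J v) (J v) v := by
  simp only [map_smul, hR.smul₁, hR.smul₂, hR.smul₃, hR.smul₄]
  ring

/-- The holomorphic curvature vanishes if it does on positive vectors. -/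
theorem IsKaehlerCurvature.holomorphic_eq_zero_of_pos (hR : IsKaehlerCurvature J R)
    (hJ : ∀ x, J (J x) = -x) {f : V} (hf : B f f = 1)
    (h : ∀ v, 0 < B v v → R v (J v) (J v) v = 0) (w : V) : R w (J w) (J w) w = 0 := by
  set b := B f w + B w f
  set c := B w w
  -- With these bounds f + sδw has square at least 1 - 1/4 - 1/2 > 0 for |s| ≤ 2, so the quartic in
  -- s vanishes at five points.
  obtain ⟨δ, hδ, hb, hc⟩ : ∃ δ : ℝ, 0 < δ ∧ δ * |b| ≤ 1 / 8 ∧ δ ^ 2 * |c| ≤ 1 / 8 := by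
    refine ⟨1 / (8 * (1 + |b| + |c|)), by positivity, ?_, ?_⟩
    · rw [div_mul_eq_mul_div, div_le_div_iff₀ (by positivity) (by positivity)]
      nlinarith [abs_nonneg b, abs_nonneg c]
    · rw [div_pow, div_mul_eq_mul_div, div_le_div_iff₀ (by positivity) (by positivity)]
      nlinarith [abs_nonneg b, abs_nonneg c, mul_nonneg (abs_nonneg b) (abs_nonneg c),
        sq_nonneg (|b|), sq_nonneg (|c|)]
  have key : ∀ s : ℝ, |s| ≤ 2 → R (f + (s * δ) • w) (J (f + (s * δ) • w)) (J (f + (s * δ) • w))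
      (f + (s * δ) • w) = 0 := by
    intro s hs
    apply h
    have e : B (f + (s * δ) • w) (f + (s * δ) • w) = 1 + s * (δ * b) + s ^ 2 * (δ ^ 2 * c) := by
      simp only [map_add, map_smul, LinearMap.add_apply, LinearMap.smul_apply, smul_eq_mul, hf]
      simp only [b, c]
      ring
    rw [e]
    have h1 : |s * (δ * b)| ≤ 2 * (1 / 8) := by
      rw [abs_mul, abs_mul, abs_of_pos hδ]
      exact mul_le_mul hs hb (by positivity) (by norm_num)
    have h2 : |s ^ 2 * (δ ^ 2 * c)| ≤ 4 * (1 / 8) := by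
      rw [abs_mul, abs_mul, abs_of_nonneg (sq_nonneg δ), abs_pow]
      refine mul_le_mul ?_ hc (by positivity) (by norm_num)
      nlinarith [abs_nonneg s]
    linarith [(abs_le.1 h1).1, (abs_le.1 h2).1]
  have k0 := key 0 (by norm_num)
  have k1 := key 1 (by norm_num)
  have k2 := key (-1) (by norm_num)
  have k3 := key 2 (by norm_num)
  have k4 := key (-2) (by norm_num)
  rw [hR.holomorphic_line hJ] at k0 k1 k2 k3 k4
  -- The fourth central difference isolates the leading coefficient.
  have : δ ^ 4 * R w (J w) (J w) w = 0 := by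
    linear_combination (k3 + k4 - 4 * (k1 + k2) + 6 * k0) / 24
  rcases mul_eq_zero.1 this with h0 | h0
  · exact absurd h0 (by positivity)
  · exact h0

/-- A Kähler curvature tensor which vanishes on isotropic planes has constant holomorphic
sectional curvature. -/
theorem IsKaehlerCurvature.exists_eq_model (h : IsHermitianPair B J)
    (hR : IsKaehlerCurvature J R) (hA : VanishesOnIsotropicPlanes B J R)
    (hN : HasManyUnitVectors B (-1)) (hP : HasManyUnitVectors B 1) :
    ∃ c : ℝ, ∀ x y z u, R x y z u = c * modelCurvature B J x y z u := by
  obtain ⟨f, hf, -, -⟩ := hP 0 0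
  -- The model takes the value 4 B(f,f)² = 4 here, hence the division.
  set c := R f (J f) (J f) f / 4 with hc
  have hR' := hR.sub (h.isKaehlerCurvature_model.const_mul c)
  refine ⟨c, fun x y z u ↦ sub_eq_zero.1 (hR'.eq_zero h.J_J ?_ x y z u)⟩
  refine hR'.holomorphic_eq_zero_of_pos h.J_J hf fun v hv ↦ ?_
  obtain ⟨t, ht⟩ := exists_smul_unit_of_pos hv
  obtain ⟨n, hn, hnf, hnv⟩ := exists_negative_ortho_pair h hN hf (t • v)
  have e1 := holomorphic_eq_of_ortho h hR hA hN hP hn hf hnf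
  have e2 := holomorphic_eq_of_ortho h hR hA hN hP hn ht hnv
  rw [e1, hR.holomorphic_smul] at e2
  have e3 : t ^ 2 * B v v = 1 := by
    rw [← ht]; simp only [map_smul, LinearMap.smul_apply, smul_eq_mul]; ring
  rw [h.model_holomorphic, hc, e2]
  linear_combination (-(R v (J v) (J v) v) * (t ^ 2 * B v v + 1)) * e3

end KaehlerAlgebra

/-! ### Constancy on a connected manifold -/

/-- A function with vanishing differential on a connected manifold is constant. -/
theorem eq_of_mvfderiv_eq_zero {E : Type v} [NormedAddCommGroup E] [NormedSpace ℝ E]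
    {M : Type u} [TopologicalSpace M] [ChartedSpace E M] [IsManifold 𝓘(ℝ, E) ∞ M]
    [ConnectedSpace M] {f : M → ℝ} (hf : ∀ p, MDifferentiableAt 𝓘(ℝ, E) 𝓘(ℝ, ℝ) f p)
    (h : ∀ p v, mvfderiv 𝓘(ℝ, E) f p v = 0) (p q : M) : f p = f q := by
  refine IsLocallyConstant.apply_eq_of_preconnectedSpace ?_ p q
  rw [IsLocallyConstant.iff_eventually_eq]
  intro p
  set e := chartAt E p
  have he : e ∈ IsManifold.maximalAtlas 𝓘(ℝ, E) 1 M := IsManifold.chart_mem_maximalAtlas p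
  have hsymm : ∀ y ∈ e.target, MDifferentiableAt 𝓘(ℝ, E) 𝓘(ℝ, E) e.symm y := fun y hy ↦
    ((contMDiffOn_symm_of_mem_maximalAtlas he).contMDiffAt
      (e.open_target.mem_nhds hy)).mdifferentiableAt one_ne_zero
  have hm : ∀ y ∈ e.target, MDifferentiableAt 𝓘(ℝ, E) 𝓘(ℝ, ℝ) (f ∘ e.symm) y := fun y hy ↦
    (hf _).comp y (hsymm y hy)
  have hd : DifferentiableOn ℝ (f ∘ e.symm) e.target := fun y hy ↦
    (mdifferentiableAt_iff_differentiableAt.1 (hm y hy)).differentiableWithinAt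
  have hz : e.target.EqOn (fderiv ℝ (f ∘ e.symm)) 0 := by
    intro y hy
    have h1 : mfderiv 𝓘(ℝ, E) 𝓘(ℝ, ℝ) f (e.symm y) = 0 := by
      ext v; exact h (e.symm y) v
    have h2 := mfderiv_comp y (hf (e.symm y)) (hsymm y hy)
    rw [h1, mfderiv_eq_fderiv] at h2
    exact h2.trans (ContinuousLinearMap.zero_comp _)
  obtain ⟨r, hr, hball⟩ := Metric.isOpen_iff.1 e.open_target (e p) (mem_chart_target E p)
  have hpre : e.source ∩ e ⁻¹' Metric.ball (e p) r ∈ 𝓝 p :=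
    e.continuousAt (mem_chart_source E p) |>.preimage_mem_nhds (Metric.ball_mem_nhds _ hr)
      |> inter_mem (e.open_source.mem_nhds (mem_chart_source E p))
  filter_upwards [hpre] with q hq
  have key := Metric.isOpen_ball.is_const_of_fderiv_eq_zero (convex_ball (e p) r).isPreconnected
    (hd.mono hball) (hz.mono hball) hq.2 (Metric.mem_ball_self hr)
  simpa [e.left_inv hq.1, e.left_inv (mem_chart_source E p)] using key

/-! ### Passage from the manifold to the algebra of a tangent space -/

namespace PseudoRiemannianMetric

variable {E : Type v} [NormedAddCommGroup E] [NormedSpace ℝ E]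
  {M : Type u} [TopologicalSpace M] [ChartedSpace E M] [IsManifold 𝓘(ℝ, E) ∞ M]

/-- The metric at `p` as a bilinear form. -/
noncomputable def form (g : PseudoRiemannianMetric E M) (p : M) :
    TangentSpace 𝓘(ℝ, E) p →ₗ[ℝ] TangentSpace 𝓘(ℝ, E) p →ₗ[ℝ] ℝ :=
  LinearMap.mk₂ ℝ (fun x y ↦ g.inner p x y) (by simp) (by simp) (by simp) (by simp)

@[simp]
theorem form_apply (g : PseudoRiemannianMetric E M) (p : M) (x y : TangentSpace 𝓘(ℝ, E) p) :
    g.form p x y = g.inner p x y := rfl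

/-- Three orthogonal unit vectors of sign `ε` span a space of definite vectors. -/
theorem hasManyUnitVectors_of_orthonormal (g : PseudoRiemannianMetric E M) {p : M} {ε : ℝ}
    {m : ℕ} (hm : 3 ≤ m) (e : Fin m → TangentSpace 𝓘(ℝ, E) p)
    (he : ∀ i j, g.inner p (e i) (e j) = if i = j then ε else 0) :
    HasManyUnitVectors (g.form p) ε := by
  intro a b
  -- Orthogonality to a and b imposes two linear conditions on at least three coefficients, so a
  -- nonzero solution exists.
  let L : (Fin m → ℝ) →ₗ[ℝ] (Fin 2 → ℝ) :=
    LinearMap.pi ![∑ i, g.inner p (e i) a • LinearMap.proj i,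
      ∑ i, g.inner p (e i) b • LinearMap.proj i]
  obtain ⟨c, hc, hc0⟩ := (Submodule.ne_bot_iff _).1
    (LinearMap.ker_ne_bot_of_finrank_lt (f := L) (by simp; omega))
  set n := ∑ i, c i • e i with hn
  have hna : g.inner p n a = 0 := by
    have := congrFun (LinearMap.mem_ker.1 hc) 0
    simpa [L, hn, mul_comm, sum_apply] using this
  have hnb : g.inner p n b = 0 := by
    have := congrFun (LinearMap.mem_ker.1 hc) 1
    simpa [L, hn, mul_comm, sum_apply] using this
  have hnn : g.inner p n n = ε * ∑ i, c i ^ 2 := by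
    simp only [hn, map_sum, map_smul, sum_apply, smul_apply, smul_eq_mul, he, Finset.mul_sum]
    refine Finset.sum_congr rfl fun i _ ↦ ?_
    simp
    ring
  have hpos : 0 < ∑ i, c i ^ 2 := by
    obtain ⟨i, hi⟩ := Function.ne_iff.1 hc0
    exact Finset.sum_pos' (fun i _ ↦ sq_nonneg _) ⟨i, Finset.mem_univ i, by
      have : c i ≠ 0 := hi
      positivity⟩
  set S := ∑ i, c i ^ 2
  refine ⟨(Real.sqrt S)⁻¹ • n, ?_, ?_, ?_⟩
  · have h2 : Real.sqrt S ^ 2 = S := Real.sq_sqrt hpos.le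
    have h1 : 0 < Real.sqrt S := Real.sqrt_pos.2 hpos
    simp only [map_smul, LinearMap.smul_apply, smul_eq_mul, form_apply, hnn]
    field_simp
    rw [h2]
    ring
  · simp [hna]
  · simp [hnb]

theorem HasSignature.hasManyUnitVectors {g : PseudoRiemannianMetric E M} {a b : ℕ}
    (h : g.HasSignature a b) (ha : 3 ≤ a) (hb : 3 ≤ b) (p : M) :
    HasManyUnitVectors (g.form p) (-1) ∧ HasManyUnitVectors (g.form p) 1 := by
  obtain ⟨e, he⟩ := h p
  exact ⟨g.hasManyUnitVectors_of_orthonormal ha (fun i ↦ e (Sum.inl i))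
      fun i j ↦ by simp [he],
    g.hasManyUnitVectors_of_orthonormal hb (fun i ↦ e (Sum.inr i))
      fun i j ↦ by simp [he]⟩

end PseudoRiemannianMetric

namespace AlmostHermitianStructure

open PseudoRiemannianMetric

variable {E : Type v} [NormedAddCommGroup E] [NormedSpace ℝ E]
  {M : Type u} [TopologicalSpace M] [ChartedSpace E M] [IsManifold 𝓘(ℝ, E) ∞ M]
  {W X Y Z : ∀ p : M, TangentSpace 𝓘(ℝ, E) p} {p : M}

theorem isHermitianPair (h : AlmostHermitianStructure E M) (p : M) :
    IsHermitianPair (h.form p) (h.J p).toLinearMap where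
  symm := h.symm p
  J_J := h.J_J p
  isometry := h.inner_J_J p

/-- The curvature operator of constant holomorphic sectional curvature `4`. -/
noncomputable def modelOperator (h : AlmostHermitianStructure E M) (p : M)
    (x y z : TangentSpace 𝓘(ℝ, E) p) : TangentSpace 𝓘(ℝ, E) p :=
  h.inner p y z • x - h.inner p x z • y + h.inner p (h.J p y) z • h.J p x
    - h.inner p (h.J p x) z • h.J p y - (2 * h.inner p (h.J p x) y) • h.J p z

theorem inner_modelOperator (h : AlmostHermitianStructure E M) (p : M)
    (x y z u : TangentSpace 𝓘(ℝ, E) p) : h.inner p (h.modelOperator p x y z) u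
      = modelCurvature (h.form p) (h.J p).toLinearMap x y z u := by
  simp [modelOperator, modelCurvature]

theorem modelOperator_sub_right (h : AlmostHermitianStructure E M) (p : M)
    (x y y' z : TangentSpace 𝓘(ℝ, E) p) : h.modelOperator p x (y - y') z
      = h.modelOperator p x y z - h.modelOperator p x y' z := by
  simp only [modelOperator, map_sub, sub_apply]
  module

theorem modelOperator_swap (h : AlmostHermitianStructure E M) (p : M)
    (x y z : TangentSpace 𝓘(ℝ, E) p) : h.modelOperator p x y z = -h.modelOperator p y x z := by
  simp only [modelOperator]
  rw [h.inner_J_left p x y, h.symm p x (h.J p y)]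
  module

variable [FiniteDimensional ℝ E]

theorem IsKaehler.isKaehlerCurvature {h : AlmostHermitianStructure E M} (hK : h.IsKaehler)
    (p : M) : IsKaehlerCurvature (h.J p).toLinearMap (h.curvature p) where
  add₄ x y z u v := by simp [PseudoRiemannianMetric.curvature]
  smul₄ t x y z u := by simp [PseudoRiemannianMetric.curvature]
  antisymm_left x y z u := by
    simp only [PseudoRiemannianMetric.curvature]
    rw [h.curvatureField_swap, map_neg, neg_apply]
  antisymm_right x y z u := by
    have e := h.inner_curvatureField_antisymm (smoothFieldNear_extend x)
      (smoothFieldNear_extend y) (smoothFieldNear_extend z) (smoothFieldNear_extend u)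
    simpa [PseudoRiemannianMetric.curvature] using e
  bianchi x y z u := by
    simp only [PseudoRiemannianMetric.curvature]
    rw [← add_apply, ← add_apply, ← map_add, ← map_add, h.curvatureField_bianchi
      (smoothFieldNear_extend x) (smoothFieldNear_extend y) (smoothFieldNear_extend z)]
    simp
  J_right x y z u := by
    have hx := smoothFieldNear_extend x
    have hy := smoothFieldNear_extend y
    have hz := smoothFieldNear_extend z
    have e := h.curvature_apply hx hy (h.smoothFieldNear_JField hz) (h.J p u)
    rw [hK.curvatureField_JField hx hy hz, h.inner_J_J, ← h.curvature_apply hx hy hz] at e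
    simpa [JField] using e

theorem vanishesOnIsotropicPlanes {h : AlmostHermitianStructure E M}
    (hax : h.SatisfiesStronglyIsotropicAntiholomorphicPlaneAxiom) (p : M) :
    VanishesOnIsotropicPlanes (h.form p) (h.J p).toLinearMap (h.curvature p) := by
  intro x y x' w hxx hyy hxy hxJy hy hx'x hx'y hx'Jy hxw hyw
  have hH := h.isHermitianPair p
  simp only [form_apply, ContinuousLinearMap.coe_coe] at hxx hyy hxy hxJy hx'x hx'y hx'Jy hxw hyw
  set α : Submodule ℝ (TangentSpace 𝓘(ℝ, E) p) := Submodule.span ℝ {x, y} with hα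
  have hxα : x ∈ α := Submodule.subset_span (by simp)
  have hyα : y ∈ α := Submodule.subset_span (by simp)
  have hli : LinearIndependent ℝ ![x, y] := by
    rw [LinearIndependent.pair_iff]
    intro a b hab
    have h1 := congrArg (h.inner p x') hab
    simp only [map_add, map_smul, hx'y, smul_eq_mul, mul_zero, add_zero, map_zero] at h1
    have ha : a = 0 := (mul_eq_zero.1 h1).resolve_right hx'x
    subst ha
    simpa [hy] using hab
  have hfin : Module.finrank ℝ α = 2 := by
    rw [hα, ← Matrix.range_cons_cons_empty x y ![], finrank_span_eq_card hli, Fintype.card_fin]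
  have hyx : h.inner p y x = 0 := by rw [h.symm, hxy]
  have hJ : ∀ v, h.inner p v (h.J p v) = 0 := hH.apply_J_self
  have hJl := h.inner_J_left p
  have hyJx : h.inner p y (h.J p x) = 0 := by rw [h.symm, hJl, hxJy, neg_zero]
  have hiso : h.IsStronglyIsotropicPlane α := by
    refine ⟨hfin, fun v hv v' hv' ↦ ?_⟩
    obtain ⟨a, b, rfl⟩ := Submodule.mem_span_pair.1 hv
    obtain ⟨c, d, rfl⟩ := Submodule.mem_span_pair.1 hv'
    simp [hxx, hyy, hxy, hyx]
  have hanti : h.IsAntiholomorphicPlane α := by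
    refine ⟨hfin, fun v hv v' hv' ↦ ?_, fun hmap ↦ ?_⟩
    · obtain ⟨a, b, rfl⟩ := Submodule.mem_span_pair.1 hv
      obtain ⟨c, d, rfl⟩ := Submodule.mem_span_pair.1 hv'
      simp [hJl, hxJy, hyJx, hJ]
    · have hJy : h.J p y ∈ α := by
        rw [← hmap]; exact Submodule.mem_map_of_mem hyα
      obtain ⟨a, b, hab⟩ := Submodule.mem_span_pair.1 hJy
      have h1 := congrArg (h.inner p x') hab
      simp only [map_add, map_smul, hx'y, hx'Jy, smul_eq_mul, mul_zero, add_zero] at h1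
      have ha : a = 0 := (mul_eq_zero.1 h1).resolve_right hx'x
      subst ha
      simp only [zero_smul, zero_add] at hab
      have h2 := congrArg (h.J p) hab
      rw [map_smul, h.J_J, ← hab, smul_smul] at h2
      -- A real eigenvalue b of J would satisfy b² = -1.
      have h3 : (b * b + 1) • y = 0 := by rw [add_smul, h2]; simp
      rcases smul_eq_zero.1 h3 with h4 | h4
      · nlinarith [sq_nonneg b]
      · exact hy h4
  clear_value α
  obtain ⟨N, _, _, _, f, -, hf, ht, ⟨q, hq, hqα⟩, -⟩ := hax p α hiso hanti
  subst hq
  simp only at hqα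
  refine ht.curvature_eq_zero (hf.isImmersionAt q) (hqα ▸ hxα) (hqα ▸ hyα) (hqα ▸ hyα) ?_
  intro v hv
  rw [hqα, hα] at hv
  obtain ⟨a, b, rfl⟩ := Submodule.mem_span_pair.1 hv
  simp [hxw, hyw]

/-- The model operator is built from g and J alone, and both are parallel, so the Leibniz rule
produces no further term. -/
theorem IsKaehler.nabla_modelOperator {h : AlmostHermitianStructure E M} (hK : h.IsKaehler)
    (hX : SmoothFieldNear X p) (hY : SmoothFieldNear Y p) (hZ : SmoothFieldNear Z p)
    (hW : SmoothFieldNear W p) :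
    SmoothFieldNear (fun q ↦ h.modelOperator q (Y q) (Z q) (W q)) p ∧
    h.nabla X (fun q ↦ h.modelOperator q (Y q) (Z q) (W q)) p
      = h.modelOperator p (h.nabla X Y p) (Z p) (W p)
        + h.modelOperator p (Y p) (h.nabla X Z p) (W p)
        + h.modelOperator p (Y p) (Z p) (h.nabla X W p) := by
  have hJY := h.smoothFieldNear_JField hY
  have hJZ := h.smoothFieldNear_JField hZ
  have hJW := h.smoothFieldNear_JField hW
  have key : ∀ {A B C : ∀ p : M, TangentSpace 𝓘(ℝ, E) p}, SmoothFieldNear A p →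
      SmoothFieldNear B p → SmoothFieldNear C p →
      SmoothFieldNear ((fun q ↦ h.inner q (A q) (B q)) • C) p ∧
      h.nabla X ((fun q ↦ h.inner q (A q) (B q)) • C) p
        = h.inner p (A p) (B p) • h.nabla X C p
          + (h.inner p (h.nabla X A p) (B p) + h.inner p (A p) (h.nabla X B p)) • C p := by
    intro A B C hA hB hC
    have hs := h.smoothFunNear_inner hA hB
    exact ⟨hC.smul hs, by rw [h.nabla_smul_right hs hC, h.mvfderiv_inner hX hA hB]⟩
  have e : (fun q ↦ h.modelOperator q (Y q) (Z q) (W q))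
      = (fun q ↦ h.inner q (Z q) (W q)) • Y - (fun q ↦ h.inner q (Y q) (W q)) • Z
        + (fun q ↦ h.inner q (h.JField Z q) (W q)) • h.JField Y
        - (fun q ↦ h.inner q (h.JField Y q) (W q)) • h.JField Z
        - (2 : ℝ) • ((fun q ↦ h.inner q (h.JField Y q) (Z q)) • h.JField W) := by
    funext q
    simp only [modelOperator, JField, Pi.sub_apply, Pi.add_apply, Pi.smul_apply, Pi.smul_apply',
      smul_smul]
  have k1 := key hZ hW hY
  have k2 := key hY hW hZ
  have k3 := key hJZ hW hJY
  have k4 := key hJY hW hJZ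
  have k5 := key hJY hZ hJW
  rw [e]
  refine ⟨(((k1.1.sub k2.1).add k3.1).sub k4.1).sub (k5.1.const_smul 2), ?_⟩
  rw [h.nabla_sub_right (((k1.1.sub k2.1).add k3.1).sub k4.1) (k5.1.const_smul 2),
    h.nabla_sub_right ((k1.1.sub k2.1).add k3.1) k4.1, h.nabla_add_right (k1.1.sub k2.1) k3.1,
    h.nabla_sub_right k1.1 k2.1, h.nabla_const_smul_right 2 k5.1, k1.2, k2.2, k3.2, k4.2, k5.2,
    hK.nabla_JField hY, hK.nabla_JField hZ, hK.nabla_JField hW]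
  simp only [modelOperator, JField]
  module

/-! ### Schur's lemma -/

/-- Schur's lemma: a pointwise constant holomorphic sectional curvature has vanishing
differential. -/
theorem IsKaehler.schur {h : AlmostHermitianStructure E M} (hK : h.IsKaehler) {c : M → ℝ}
    (hc : ∀ p x y z u, h.curvature p x y z u
      = c p * modelCurvature (h.form p) (h.J p).toLinearMap x y z u)
    (hN : ∀ p, HasManyUnitVectors (h.form p) (-1)) (p : M) :
    SmoothFunNear E c p ∧ ∀ v, mvfderiv 𝓘(ℝ, E) c p v = 0 := by
  have hfield : ∀ {X Y Z : ∀ p : M, TangentSpace 𝓘(ℝ, E) p} {p : M}, SmoothFieldNear X p →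
      SmoothFieldNear Y p → SmoothFieldNear Z p →
      h.curvatureField X Y Z p = c p • h.modelOperator p (X p) (Y p) (Z p) := by
    intro X Y Z p hX hY hZ
    rw [← sub_eq_zero]
    refine h.nondegenerate p _ fun u ↦ ?_
    rw [map_sub, sub_apply, ← h.curvature_apply hX hY hZ, hc, map_smul, smul_apply,
      h.inner_modelOperator, smul_eq_mul, sub_self]
  -- The function c is given only pointwise; near `p` it equals R(X,JX,JX,X) / (4 g(X,X)²) for a
  -- field X with g(X,X) = -1 at `p`, which is smooth.
  have hsmooth : SmoothFunNear E c p := by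
    obtain ⟨n, hn, -, -⟩ := hN p 0 0
    have hX := smoothFieldNear_extend n
    set X := FiberBundle.extend E n with hXdef
    have hXp : h.inner p (X p) (X p) = -1 := by
      rw [hXdef, FiberBundle.extend_apply_self]; exact hn
    have hJX := h.smoothFieldNear_JField hX
    have h1 := h.smoothFunNear_inner (h.smoothFieldNear_curvatureField hX hJX hJX) hX
    have h2 := h.smoothFunNear_inner hX hX
    have h3 : ∀ᶠ q in 𝓝 p, h.inner q (X q) (X q) ≠ 0 :=
      h2.contMDiffAt.continuousAt.eventually_ne (by rw [hXp]; norm_num)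
    have h4 : SmoothFunNear E (fun q ↦ (4 * (h.inner q (X q) (X q) * h.inner q (X q) (X q)))⁻¹)
        p := by
      filter_upwards [((SmoothFunNear.const 4).mul (h2.mul h2) : SmoothFunNear E _ p), h3]
        with q hq hq'
      exact hq.inv₀ (by simpa using hq')
    refine (h1.mul h4).congr ?_
    filter_upwards [hX.eventually, hJX.eventually, h3] with q h5 h6 h7
    have e := (h.isHermitianPair q).model_holomorphic (X q)
    rw [hfield h5 h6 h6, map_smul, smul_apply, h.inner_modelOperator]
    simp only [JField, form_apply, ContinuousLinearMap.coe_coe] at e ⊢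
    rw [e, smul_eq_mul]
    field_simp
  refine ⟨hsmooth, fun v ↦ ?_⟩
  have hnab : ∀ {X Y Z W : ∀ p : M, TangentSpace 𝓘(ℝ, E) p}, SmoothFieldNear X p →
      SmoothFieldNear Y p → SmoothFieldNear Z p → SmoothFieldNear W p →
      h.nabla X (h.curvatureField Y Z W) p - h.curvatureField Y Z (h.nabla X W) p
        = mvfderiv 𝓘(ℝ, E) c p (X p) • h.modelOperator p (Y p) (Z p) (W p)
          + c p • (h.modelOperator p (h.nabla X Y p) (Z p) (W p)
            + h.modelOperator p (Y p) (h.nabla X Z p) (W p)) := by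
    intro X Y Z W hX hY hZ hW
    obtain ⟨h1, h2⟩ := hK.nabla_modelOperator hX hY hZ hW
    have h3 : ∀ᶠ q in 𝓝 p, h.curvatureField Y Z W q
        = (c • fun q ↦ h.modelOperator q (Y q) (Z q) (W q)) q := by
      filter_upwards [hY.eventually, hZ.eventually, hW.eventually] with q k1 k2 k3
      exact hfield k1 k2 k3
    rw [h.nabla_congr (h1.smul hsmooth) h3, h.nabla_smul_right hsmooth h1, h2,
      hfield hY hZ (h.smoothFieldNear_nabla hX hW)]
    module
  have : CompleteSpace E := FiniteDimensional.complete ℝ E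
  -- Second Bianchi is applied to v, y, Jy acting on y. Since y is a unit vector orthogonal to v and
  -- Jv, pairing the result with Jy kills the terms in dc(y) and dc(Jy) and leaves -4 dc(v) = 0.
  obtain ⟨y, hy, hyv, hyJv⟩ := hN p v (h.J p v)
  simp only [form_apply] at hy hyv hyJv
  have hX := smoothFieldNear_extend v
  have hY := smoothFieldNear_extend y
  have hXv : FiberBundle.extend E v p = v := by simp
  have hYy : FiberBundle.extend E y p = y := by simp
  set X := FiberBundle.extend E v
  set Y := FiberBundle.extend E y
  have hZ := h.smoothFieldNear_JField hY
  have hZp : h.JField Y p = h.J p y := by rw [JField, hYy]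
  set Z := h.JField Y
  have hB := h.second_bianchi hX hY hZ hY
  rw [hnab hX hY hZ hY, hnab hY hZ hX hY, hnab hZ hX hY hY,
    hfield hX (smoothFieldNear_mlieBracket hY hZ) hY,
    hfield hY (smoothFieldNear_mlieBracket hZ hX) hY,
    hfield hZ (smoothFieldNear_mlieBracket hX hY) hY, ← h.nabla_sub_nabla hY hZ,
    ← h.nabla_sub_nabla hZ hX, ← h.nabla_sub_nabla hX hY, h.modelOperator_sub_right,
    h.modelOperator_sub_right, h.modelOperator_sub_right,
    h.modelOperator_swap p (h.nabla X Y p), h.modelOperator_swap p (h.nabla Y Z p),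
    h.modelOperator_swap p (h.nabla Z X p)] at hB
  -- All terms containing derivatives of the fields cancel against the bracket terms, as torsion
  -- vanishes; only the derivatives of c survive.
  have hB' : mvfderiv 𝓘(ℝ, E) c p v • h.modelOperator p y (h.J p y) y
      + mvfderiv 𝓘(ℝ, E) c p y • h.modelOperator p (h.J p y) v y
      + mvfderiv 𝓘(ℝ, E) c p (h.J p y) • h.modelOperator p v y y = 0 := by
    rw [hXv, hYy, hZp] at hB
    rw [← hB]
    module
  have h0 := congrArg (fun w ↦ h.inner p w (h.J p y)) hB'
  have hH := h.isHermitianPair p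
  have hJy : h.inner p y (h.J p y) = 0 := hH.apply_J_self y
  have hvy : h.inner p v y = 0 := by rw [h.symm, hyv]
  have hvJy : h.inner p v (h.J p y) = 0 := by
    rw [h.symm, h.inner_J_left, hyJv, neg_zero]
  simp only [map_add, map_smul, add_apply, smul_apply, smul_eq_mul, inner_modelOperator,
    modelCurvature, form_apply, ContinuousLinearMap.coe_coe, h.inner_J_J, h.J_J, map_neg,
    LinearMap.neg_apply, h.inner_J_left, hy, hyv, hJy, hvy, hvJy, map_zero, zero_apply] at h0
  linarith

end AlmostHermitianStructure

/-! ### Holomorphic sectional curvature on an arbitrary basis -/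

theorem theorem11 {E : Type v} [NormedAddCommGroup E] [NormedSpace ℝ E] [FiniteDimensional ℝ E]
    {M : Type u} [TopologicalSpace M] [ChartedSpace E M] [IsManifold 𝓘(ℝ, E) ∞ M]
    [T2Space M] [ConnectedSpace M]
    (h : AlmostHermitianStructure E M) (s n : ℕ) (hs : 2 ≤ s) (hns : 2 ≤ n - s)
    (hsig : h.HasSignature (2 * s) (2 * (n - s)))
    (hK : h.IsKaehler)
    (hax : h.SatisfiesStronglyIsotropicAntiholomorphicPlaneAxiom) :
    h.HasConstantHolomorphicSectionalCurvature := by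
  have hU := fun p ↦ hsig.hasManyUnitVectors (by omega) (by omega) p
  have hpt := fun p ↦ (hK.isKaehlerCurvature p).exists_eq_model (h.isHermitianPair p)
    (AlmostHermitianStructure.vanishesOnIsotropicPlanes hax p) (hU p).1 (hU p).2
  choose c hc using hpt
  have hS := hK.schur hc fun p ↦ (hU p).1
  have hconst := eq_of_mvfderiv_eq_zero (fun p ↦ (hS p).1.mdiffAt) fun p ↦ (hS p).2
  obtain ⟨p₀⟩ : Nonempty M := inferInstance
  -- The factor 4 is the holomorphic sectional curvature of the model tensor.
  refine ⟨4 * c p₀, fun p x y hnd hhol ↦ ?_⟩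
  set α := Submodule.span ℝ {x, y} with hα
  have hxα : x ∈ α := Submodule.subset_span (by simp)
  have hyα : y ∈ α := Submodule.subset_span (by simp)
  have hli : LinearIndependent ℝ ![x, y] := by
    rw [linearIndependent_iff_card_eq_finrank_span]
    rw [Set.finrank, Matrix.range_cons_cons_empty, ← hα, hhol.1, Fintype.card_fin]
  have hx0 : x ≠ 0 := by simpa using hli.ne_zero 0
  have hH := h.isHermitianPair p
  have hJx0 : h.inner p x (h.J p x) = 0 := hH.apply_J_self x
  have hJxα : h.J p x ∈ α := by
    rw [← hhol.2]; exact Submodule.mem_map_of_mem hxα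
  obtain ⟨a, b, hab⟩ := Submodule.mem_span_pair.1 hJxα
  have hb : b ≠ 0 := by
    rintro rfl
    simp only [zero_smul, add_zero] at hab
    have h2 := congrArg (h.J p) hab
    rw [map_smul, h.J_J, ← hab, smul_smul] at h2
    have h3 : (a * a + 1) • x = 0 := by rw [add_smul, h2]; simp
    rcases smul_eq_zero.1 h3 with h4 | h4
    · nlinarith [sq_nonneg a]
    · exact hx0 h4
  -- Passing to the basis x, Jx is possible because J has no real eigenvector, so b ≠ 0. Numerator
  -- and denominator then scale by the same t².
  have hy : y = (-a / b) • x + (1 / b) • h.J p x := by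
    rw [← hab]
    match_scalars
    · field_simp
    · field_simp
      ring
  set r := -a / b
  set t := 1 / b
  have ht : t ≠ 0 := one_div_ne_zero hb
  -- A null x would be orthogonal to both x and Jx, hence to the whole plane, against nondegeneracy.
  have hxx : h.inner p x x ≠ 0 := by
    intro h0
    refine hx0 (hnd.2 x hxα fun z hz ↦ ?_)
    obtain ⟨k, l, rfl⟩ := Submodule.mem_span_pair.1 hz
    rw [hy]
    simp [h0, hJx0]
  have hden : h.inner p x x * h.inner p y y - h.inner p x y ^ 2 = t ^ 2 * h.inner p x x ^ 2 := by
    rw [hy]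
    simp only [map_add, map_smul, add_apply, smul_apply, smul_eq_mul, h.inner_J_J, hJx0,
      h.inner_J_left]
    ring
  have hnum : h.curvature p x y y x = 4 * c p₀ * (t ^ 2 * h.inner p x x ^ 2) := by
    rw [hc, hconst p p₀, hy]
    simp only [modelCurvature, AlmostHermitianStructure.inner_J_left,
      PseudoRiemannianMetric.form_apply, ContinuousLinearMap.coe_coe, map_add, map_smul,
      smul_eq_mul, h.inner_J_J, hJx0, h.J_J, map_neg,
      LinearMap.add_apply, LinearMap.smul_apply, LinearMap.neg_apply]
    ring
  rw [PseudoRiemannianMetric.sectionalCurvature, hden, hnum]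
  field_simp
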